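/- Let $r\ge 3$, $q=2^r$, and let $\mathbb F_q$ be the field with $q$ elements. Let $tr:\mathbb F_q\to\mathbb F_2$ be the absolute trace and $\lambda(x)=(-1)^{tr(x)}$ the canonical additive character. For $m\ge1$ and $a\in\mathbb F_q^*$ put $$K_m(\lambda;a)=\sum_{\alpha_1,\dots,\alpha_m\in\mathbb F_q^*}\lambda(\alpha_1+\cdots+\alpha_m+a\alpha_1^{-1}\cdots\alpha_m^{-1}),\qquad MK_m^h=\sum_{a\in\mathbb F_q^*}K_m(\lambda;a)^h\quad(h\ge0),$$ and $K=K_1$, $MK^h=MK_1^h$. For $k\ge 1$ let $C_k$ (respectively $D_k$) be the binary linear code of all $u\in\mathbb F_2^{(q-1)^k}$, with coordinates indexed by $(\alpha_1,\dots,\alpha_k)\in(\mathbb F_q^*)^k$, whose usual inner product in $\mathbb F_q^{(q-1)^k}$ with the vector $(\alpha_1+\cdots+\alpha_k+\alpha_1^{-1}\cdots\alpha_k^{-1})_{\alpha}$ (respectively $(\alpha_1+\cdots+\alpha_k+\alpha_1^{-1}+\cdots+\alpha_k^{-1})_{\alpha}$) is $0$. Let $C_{k,j}$ (respectively $D_{k,j}$)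 be the number of codewords of Hamming weight $j$ in it. $S(h,t)$ denotes the Stirling number of the second kind, and $\binom{n}{k}=0$ for $k<0$. Below, $t$ as an index of a product runs over all integers with $|t|<2\sqrt q$ and $t\equiv-1\pmod 4$, and $\prod_{K(\lambda;\beta^{-1})=t}$ is over the $\beta\in\mathbb F_q^*$ with $K(\lambda;\beta^{-1})=t$. (1) For all $h\ge1$, $$MK^{h}=\sum_{l=0}^{h-1}(-1)^{h+l+1}\binom hl(q-1)^{h-l}MK^{l}+q\sum_{j=0}^{\min\{q-1,h\}}(-1)^{h+j}C_{1,j}\sum_{t=j}^{h}t!\,S(h,t)2^{h-t}\binom{q-1-j}{q-1-t},$$ and for $0\le j\le q-1$ $$C_{1,j}=\sum\binom1{\nu_0}\prod_{\beta\in\mathbb F_q^*,\ tr(\beta^{-1})=0}\binom2{\nu_\beta},$$ the sum being over all families of nonnegative integers $\nu_0$, $\nu_\beta$ ($\beta\in\mathbb F_q^*$, $tr(\beta^{-1})=0$) with $\nu_0+\sum\nu_\beta=j$ and $\sum\nu_\beta\beta=0$ in $\mathbb F_q$. (2) For all $h\ge1$, $$MK_3^{h}=\sum_{l=0}^{h-1}(-1)^{h+l+1}\binom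 hl(q-1)^{3(h-l)}MK_3^{l}+q\sum_{j=0}^{\min\{(q-1)^3,h\}}(-1)^{h+j}C_{3,j}\sum_{t=j}^{h}t!\,S(h,t)2^{h-t}\binom{(q-1)^3-j}{(q-1)^3-t},$$ and for $0\le j\le(q-1)^3$ $$C_{3,j}=\sum\binom{m_0}{\nu_0}\prod_{t}\ \prod_{K(\lambda;\beta^{-1})=t}\binom{m_t}{\nu_\beta},\qquad m_0=q^2-3q+3,\quad m_t=t^2+q^2-4q+3,$$ the sum being over all families $(\nu_\beta)_{\beta\in\mathbb F_q}$ of nonnegative integers with $$\sum_{\beta\in\mathbb F_q}\nu_\beta=j\quad\text{and}\quad\sum_{\beta\in\mathbb F_q}\nu_\beta\beta=0\ \text{ in }\mathbb F_q.\tag{$*$}$$ (3) For all $h\ge1$, $$MK^{2h}=\sum_{l=0}^{h-1}(-1)^{h+l+1}\binom hl(q-1)^{2(h-l)}MK^{2l}+q\sum_{j=0}^{\min\{(q-1)^2,h\}}(-1)^{h+j}D_{2,j}\sum_{t=j}^{h}t!\,S(h,t)2^{h-t}\binom{(q-1)^2-j}{(q-1)^2-t},$$ and for $0\le j\le(q-1)^2$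 $$D_{2,j}=\sum\binom{2q-3}{\nu_0}\prod_{\beta\in\mathbb F_q^*}\binom{K(\lambda;\beta^{-1})+q-3}{\nu_\beta}=\sum\binom{2q-3}{\nu_0}\prod_{t}\ \prod_{K(\lambda;\beta^{-1})=t}\binom{t+q-3}{\nu_\beta},$$ both sums being over all families $(\nu_\beta)_{\beta\in\mathbb F_q}$ of nonnegative integers satisfying $(*)$. (4) For all $h\ge1$, with the same $D_{2,j}$, $$MK_2^{h}=\sum_{l=0}^{h-1}(-1)^{h+l+1}\binom hl(q^2-3q+1)^{h-l}MK_2^{l}+q\sum_{j=0}^{\min\{(q-1)^2,h\}}(-1)^{h+j}D_{2,j}\sum_{t=j}^{h}t!\,S(h,t)2^{h-t}\binom{(q-1)^2-j}{(q-1)^2-t}.$$ -/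

import Mathlib

open scoped Nat

namespace KloostermanMoments

noncomputable section

/-- The binomial coefficient `n.choose k` for integers `n` and `k`; it is `0` for `k < 0`. -/
def binom (n k : ℤ) : ℤ := if 0 ≤ k then Ring.choose n k.toNat else 0

section Sums

variable {F : Type*} [Field F] [Fintype F] [DecidableEq F] [Algebra (ZMod 2) F]

/-- The absolute trace `tr : F → 𝔽₂`. -/
def tr (x : F) : ZMod 2 := Algebra.trace (ZMod 2) F x

/-- The canonical additive character `λ(x) = (-1) ^ tr x`; its values are `1` and `-1`. -/
def lam (x : F) : ℤ := (-1) ^ (tr x).val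

/-- The `m`-dimensional Kloosterman sum
`K_m(λ; a) = ∑ λ(α₁ + ⋯ + α_m + a α₁⁻¹ ⋯ α_m⁻¹)` over `α₁, …, α_m ∈ F*`. -/
def K (m : ℕ) (a : Fˣ) : ℤ :=
  ∑ α : Fin m → Fˣ, lam (∑ i, (α i : F) + (a : F) * ∏ i, (α i : F)⁻¹)

variable (F) in
/-- The moment `MK_m ^ h = ∑_{a ∈ F*} K_m(λ; a) ^ h`. -/
def MK (m h : ℕ) : ℤ := ∑ a : Fˣ, K m a ^ h

end Sums

section Codes

variable {F : Type*} [Field F] [Algebra (ZMod 2) F]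

/-- The binary linear code of all `u ∈ 𝔽₂^ι` whose usual inner product with `v ∈ F^ι` is `0`. -/
def binaryCode {ι : Type*} [Fintype ι] (v : ι → F) : Submodule (ZMod 2) (ι → ZMod 2) where
  carrier := {u | ∑ i, algebraMap (ZMod 2) F (u i) * v i = 0}
  zero_mem' := by simp
  add_mem' := by
    intro x y hx hy
    simp only [Set.mem_ofPred_eq] at hx hy ⊢
    simp [add_mul, Finset.sum_add_distrib, hx, hy]
  smul_mem' := by
    intro c x hx
    simp only [Set.mem_ofPred_eq] at hx ⊢
    simp [mul_assoc, ← Finset.mul_sum, hx]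

/-- The number of codewords of Hamming weight `j` in a binary code. -/
def weightCount {ι : Type*} [Fintype ι] (B : Submodule (ZMod 2) (ι → ZMod 2)) (j : ℕ) : ℕ :=
  Nat.card {u : ι → ZMod 2 // u ∈ B ∧ hammingNorm u = j}

variable (F) [Fintype F] [DecidableEq F]

/-- The code `C_k` of length `(q - 1) ^ k`, with coordinates indexed by `(F*)^k`, attached to the
vector with entries `α₁ + ⋯ + α_k + α₁⁻¹ ⋯ α_k⁻¹`. -/
def codeC (k : ℕ) : Submodule (ZMod 2) ((Fin k → Fˣ) → ZMod 2) :=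
  binaryCode fun α => ∑ i, (α i : F) + ∏ i, (α i : F)⁻¹

/-- The code `D_m` of length `(q - 1) ^ m`, with coordinates indexed by `(F*)^m`, attached to the
vector with entries `α₁ + ⋯ + α_m + α₁⁻¹ + ⋯ + α_m⁻¹`. -/
def codeD (m : ℕ) : Submodule (ZMod 2) ((Fin m → Fˣ) → ZMod 2) :=
  binaryCode fun α => ∑ i, (α i : F) + ∑ i, (α i : F)⁻¹

end Codes

section Families

variable {F : Type*} [Field F] [Fintype F] [DecidableEq F]

/-- The families `(ν_β)_{β ∈ S}` of nonnegative integers (extended by `0` outside `S`) with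
`∑ ν_β = j` and `∑ ν_β β = 0`. -/
def families (S : Finset F) (j : ℕ) : Finset (F → ℕ) :=
  (S.piAntidiag j).filter fun ν => ∑ β ∈ S, (ν β : F) * β = 0

variable (F) in
/-- The nonzero `β` with `tr (β⁻¹) = 0`. -/
def traceZero [Algebra (ZMod 2) F] : Finset F :=
  Finset.univ.filter fun β => β ≠ 0 ∧ tr β⁻¹ = 0

end Families

/-- The integers `t` with `|t| < 2 √q` and `t ≡ -1 (mod 4)`; see `mem_valueRange`. -/
def valueRange (q : ℕ) : Finset ℤ :=
  (Finset.Icc (-(2 * q : ℤ)) (2 * q)).filter fun t =>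
    |(t : ℝ)| < 2 * √(q : ℝ) ∧ t ≡ -1 [ZMOD 4]

theorem mem_valueRange (q : ℕ) (t : ℤ) :
    t ∈ valueRange q ↔ |(t : ℝ)| < 2 * √(q : ℝ) ∧ t ≡ -1 [ZMOD 4] := by
  simp only [valueRange, Finset.mem_filter, Finset.mem_Icc, and_iff_right_iff_imp]
  rintro ⟨h, -⟩
  have h1 : √(q : ℝ) ≤ q := by
    rw [Real.sqrt_le_left (by positivity)]
    exact_mod_cast Nat.le_self_pow two_ne_zero q
  have h2 : |(t : ℝ)| ≤ 2 * q := by linarith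
  rw [abs_le] at h2
  exact ⟨by exact_mod_cast h2.1, by exact_mod_cast h2.2⟩

end

end KloostermanMoments

namespace KloostermanMoments

/-!
Write `q = |F|`. The words `(tr (x v_i))_i`, for `x ∈ F`, span the dual of `binaryCode v`, and
`∑ᵢ λ(x v_i)` is the length minus twice the weight of such a word. The MacWilliams identity,
compared coefficientwise and combined with the Stirling expansion of `h`-th powers, therefore
expresses the power moments of `∑ᵢ λ(x v_i)` through the weight distribution of `binaryCode v`
(Pless). For `C_k` with `k + 1` a power of two this sum is `K_k(λ; x ^ (k + 1)) = K_k(λ; x)`, and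
for `D_2` it is `K(λ; x)²`, which equals `K_2(λ; x) + q` by Carlitz.

A codeword is a set of coordinates on which the entries of `v` sum to `0`. Sorting these sets by
the number `ν_β` of coordinates with entry `β` leaves a product of binomial coefficients, whose
upper entries, the fibre sizes of `v`, come from orthogonality of characters.

The bound `|K(λ; a)| < 2 √q` is Manin's elementary argument. On a quadratic twist over `F(X)` of
the curve `y² + xy = x³ + a²`, let `x_n` be the `x`-coordinate of `Frob P + n P`, where
`P = (X, 0)`. As `x_{n + 1}` and `x_{n - 1}` are the roots of a quadratic with coefficients
depending only on `x_n`, their heights satisfy `h_{n + 1} + h_{n - 1} ≤ 2 h_n + 2`. Cancellation in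
`x_1` happens at the zeros of `tr(x + a / x)`, so `h_1` is governed by `K(λ; a)`, and
`0 ≤ h_n ≤ n² - n K(λ; a) + q` follows. At `n = (K(λ; a) - 1) / 2` the right-hand
side is `q - n (n + 1)`, which is not `0` because `n` is odd.
-/

theorem exists_mul_eq_of_quadratic_eq_zero {R : Type*} [CommRing R] {A B D f g : R}
    (hfg : IsCoprime f g) (hroot : A * f ^ 2 + B * f * g + D * g ^ 2 = 0) :
    ∃ f' g', A = g * g' ∧ B = -(f * g' + f' * g) ∧ D = f * f' := by
  obtain ⟨u, v, hΔ⟩ := hfg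
  -- The form is `L (β M + γ L)` in the unimodular coordinates `L = g x - f y`, `M = u x + v y`.
  let β := 2 * A * f * v + B * (g * v - f * u) - 2 * D * g * u
  let γ := A * v ^ 2 - B * u * v + D * u ^ 2
  refine ⟨γ * f - β * v, β * u + γ * g, ?_, ?_, ?_⟩ <;> simp only [β, γ]
  · linear_combination u ^ 2 * hroot - A * (1 + (u * f + v * g)) * hΔ
  · linear_combination 2 * u * v * hroot - B * (1 + (u * f + v * g)) * hΔ
  · linear_combination v ^ 2 * hroot - D * (1 + (u * f + v * g)) * hΔ

section Heights

open Polynomial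

variable {F : Type*} [Field F] {b : F} {f g f₀ g₀ f₁ g₁ f₂ g₂ : F[X]}

/-- The height of the point `f / g` of the projective line over `F(X)`, for coprime `f` and `g`. -/
def height (f g : F[X]) : ℕ := max f.natDegree g.natDegree

theorem natDegree_left_le_height : f.natDegree ≤ height f g := le_max_left _ _

theorem natDegree_right_le_height : g.natDegree ≤ height f g := le_max_right _ _

theorem coeff_height_ne_zero (h : f ≠ 0 ∨ g ≠ 0) :
    f.coeff (height f g) ≠ 0 ∨ g.coeff (height f g) ≠ 0 := by
  rcases eq_or_ne f 0 with rfl | hf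
  · simpa [height] using h
  rcases eq_or_ne g 0 with rfl | hg
  · simpa [height] using h
  rcases max_choice f.natDegree g.natDegree with hmax | hmax
  · exact .inl (by simpa [height, hmax] using hf)
  · exact .inr (by simpa [height, hmax] using hg)

theorem height_add_height_le {n : ℕ} (h₀ : f₀ ≠ 0 ∨ g₀ ≠ 0) (h₂ : f₂ ≠ 0 ∨ g₂ ≠ 0)
    (hA : (g₀ * g₂).natDegree ≤ n) (hB : (f₀ * g₂ + f₂ * g₀).natDegree ≤ n)
    (hD : (f₀ * f₂).natDegree ≤ n) : height f₀ g₀ + height f₂ g₂ ≤ n := by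
  by_contra! hn
  have eA := coeff_eq_zero_of_natDegree_lt (hA.trans_lt hn)
  have eB := coeff_eq_zero_of_natDegree_lt (hB.trans_lt hn)
  have eD := coeff_eq_zero_of_natDegree_lt (hD.trans_lt hn)
  rw [coeff_mul_add_eq_of_natDegree_le natDegree_right_le_height natDegree_right_le_height] at eA
  rw [coeff_mul_add_eq_of_natDegree_le natDegree_left_le_height natDegree_left_le_height] at eD
  rw [coeff_add,
    coeff_mul_add_eq_of_natDegree_le natDegree_left_le_height natDegree_right_le_height,
    add_comm (height f₀ g₀),
    coeff_mul_add_eq_of_natDegree_le natDegree_left_le_height natDegree_right_le_height] at eB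
  grind [coeff_height_ne_zero h₀, coeff_height_ne_zero h₂]

/-- The biquadratic relation between the `x`-coordinates `f₀ / g₀` of a point `P` and `f₁ / g₁` of
`P ± (X, 0)` on the curve `y² + xy = x³ + (X + b / X²) x² + b` over `F(X)` in characteristic two,
with denominators cleared. -/
noncomputable def biquadratic (b : F) (f₀ g₀ f₁ g₁ : F[X]) : F[X] :=
  f₀ ^ 2 * f₁ ^ 2 + X ^ 2 * (f₀ ^ 2 * g₁ ^ 2 + g₀ ^ 2 * f₁ ^ 2) + X * f₀ * g₀ * f₁ * g₁
    + C b * g₀ ^ 2 * g₁ ^ 2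

theorem biquadratic_eq_quadratic (b : F) (f₀ g₀ f₁ g₁ : F[X]) :
    biquadratic b f₀ g₀ f₁ g₁ = (f₁ ^ 2 + X ^ 2 * g₁ ^ 2) * f₀ ^ 2 + X * f₁ * g₁ * f₀ * g₀
      + (X ^ 2 * f₁ ^ 2 + C b * g₁ ^ 2) * g₀ ^ 2 := by
  rw [biquadratic]; ring

theorem biquadratic_comm (b : F) (f₀ g₀ f₁ g₁ : F[X]) :
    biquadratic b f₀ g₀ f₁ g₁ = biquadratic b f₁ g₁ f₀ g₀ := by
  simp only [biquadratic]; ring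

theorem biquadratic_mul_mul (b : F) (f₀ g₀ f₁ g₁ d : F[X]) :
    biquadratic b f₀ g₀ (d * f₁) (d * g₁) = d ^ 2 * biquadratic b f₀ g₀ f₁ g₁ := by
  simp only [biquadratic]; ring

theorem height_le_height_mul {d : F[X]} (hd : d ≠ 0) : height f g ≤ height (d * f) (d * g) := by
  have hle (p : F[X]) : p.natDegree ≤ (d * p).natDegree := by
    rcases eq_or_ne p 0 with rfl | hp
    · simp
    · exact natDegree_le_of_dvd (dvd_mul_left p d) (mul_ne_zero hd hp)
  exact max_le_max (hle f) (hle g)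

theorem exists_isCoprime_of_biquadratic_eq_zero (h : f ≠ 0 ∨ g ≠ 0)
    (hΦ : biquadratic b f₁ g₁ f g = 0) :
    ∃ f' g', IsCoprime f' g' ∧ biquadratic b f₁ g₁ f' g' = 0 ∧ height f' g' ≤ height f g := by
  classical
  obtain ⟨f', g', hf, hg, hunit⟩ := extract_gcd f g
  have hd : GCDMonoid.gcd f g ≠ 0 := by simpa [gcd_eq_zero_iff, imp_iff_not_or] using h
  generalize GCDMonoid.gcd f g = d at hf hg hd
  subst hf hg
  rw [biquadratic_mul_mul] at hΦ
  exact ⟨f', g', (gcd_isUnit_iff f' g').mp hunit,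
    (mul_eq_zero.mp hΦ).resolve_left (pow_ne_zero 2 hd), height_le_height_mul hd⟩

theorem height_add_height_le_of_vieta (h₀ : f₀ ≠ 0 ∨ g₀ ≠ 0) (h₂ : f₂ ≠ 0 ∨ g₂ ≠ 0)
    (hA : f₁ ^ 2 + X ^ 2 * g₁ ^ 2 = g₀ * g₂) (hB : X * f₁ * g₁ = -(f₀ * g₂ + f₂ * g₀))
    (hD : X ^ 2 * f₁ ^ 2 + C b * g₁ ^ 2 = f₀ * f₂) :
    height f₀ g₀ + height f₂ g₂ ≤ 2 * height f₁ g₁ + 2 := by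
  have hf : f₁.natDegree ≤ height f₁ g₁ := natDegree_left_le_height
  have hg : g₁.natDegree ≤ height f₁ g₁ := natDegree_right_le_height
  have hX : (X : F[X]).natDegree ≤ 1 := natDegree_X_le
  have hX2 : (X ^ 2 : F[X]).natDegree ≤ 2 := natDegree_X_pow_le 2
  have hf2 := natDegree_pow_le_of_le 2 hf
  have hg2 := natDegree_pow_le_of_le 2 hg
  apply height_add_height_le h₀ h₂
  · rw [← hA]
    exact natDegree_add_le_of_degree_le (by omega)
      ((natDegree_mul_le_of_le hX2 hg2).trans_eq (add_comm _ _))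
  · rw [← natDegree_neg, ← hB]
    exact (natDegree_mul_le_of_le (natDegree_mul_le_of_le hX hf) hg).trans (by omega)
  · rw [← hD]
    exact natDegree_add_le_of_degree_le
      ((natDegree_mul_le_of_le hX2 hf2).trans_eq (add_comm _ _))
      ((natDegree_C_mul_le b _).trans (by omega))

theorem exists_biquadratic_eq_zero_and_height_add_height_le (h₀ : IsCoprime f₀ g₀)
    (h₁ : IsCoprime f₁ g₁) (hΦ : biquadratic b f₀ g₀ f₁ g₁ = 0) :
    ∃ f₂ g₂, IsCoprime f₂ g₂ ∧ biquadratic b f₁ g₁ f₂ g₂ = 0 ∧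
      height f₀ g₀ + height f₂ g₂ ≤ 2 * height f₁ g₁ + 2 := by
  rw [biquadratic_eq_quadratic] at hΦ
  obtain ⟨f₂, g₂, hA, hB, hD⟩ := exists_mul_eq_of_quadratic_eq_zero h₀ hΦ
  have h₂ : f₂ ≠ 0 ∨ g₂ ≠ 0 := by
    by_contra! h
    obtain ⟨rfl, rfl⟩ := h
    rcases h₁.ne_zero_or_ne_zero with h | h <;> simp_all
  have hΦ₂ : biquadratic b f₁ g₁ f₂ g₂ = 0 := by
    rw [biquadratic_comm, biquadratic_eq_quadratic, hA, hB, hD]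
    ring
  obtain ⟨f, g, hfg, hz, hle⟩ := exists_isCoprime_of_biquadratic_eq_zero h₂ hΦ₂
  have := height_add_height_le_of_vieta h₀.ne_zero_or_ne_zero h₂ hA hB hD
  exact ⟨f, g, hfg, hz, by omega⟩

theorem exists_height_le_sq_add_mul {c : ℤ} (h₀ : IsCoprime f₀ g₀) (h₁ : f₁ ≠ 0 ∨ g₁ ≠ 0)
    (hΦ : biquadratic b f₀ g₀ f₁ g₁ = 0) (hc : (height f₁ g₁ : ℤ) ≤ height f₀ g₀ + c + 1) (n : ℕ) :
    ∃ f g f' g', IsCoprime f g ∧ IsCoprime f' g' ∧ biquadratic b f g f' g' = 0 ∧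
      (height f g : ℤ) ≤ n ^ 2 + n * c + height f₀ g₀ ∧
      (height f' g' : ℤ) ≤ height f g + c + 2 * n + 1 := by
  induction n with
  | zero =>
    obtain ⟨f', g', h', hz, hh⟩ := exists_isCoprime_of_biquadratic_eq_zero h₁ hΦ
    exact ⟨f₀, g₀, f', g', h₀, h', hz, by simp, by push_cast; omega⟩
  | succ n ih =>
    obtain ⟨f, g, f', g', h, h', hz, hn, hd⟩ := ih
    obtain ⟨f₂, g₂, h₂, hz₂, hh⟩ := exists_biquadratic_eq_zero_and_height_add_height_le h h' hz
    exact ⟨f', g', f₂, g₂, h', h₂, hz₂, by push_cast; linarith, by push_cast; omega⟩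

theorem quadratic_nonneg_of_height_le {c : ℤ} (h₀ : IsCoprime f₀ g₀) (h₁ : f₁ ≠ 0 ∨ g₁ ≠ 0)
    (hΦ : biquadratic b f₀ g₀ f₁ g₁ = 0) (hc : (height f₁ g₁ : ℤ) ≤ height f₀ g₀ + c + 1) (n : ℕ) :
    0 ≤ (n : ℤ) ^ 2 + n * c + height f₀ g₀ := by
  obtain ⟨f, g, -, -, -, -, -, hn, -⟩ := exists_height_le_sq_add_mul h₀ h₁ hΦ hc n
  exact (Int.natCast_nonneg _).trans hn

end Heights

section Weil

open Polynomial

variable {F : Type*} [Field F]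

/-- The polynomial `X ∏_{c ∈ Z} (X - c)²`, cancelled from the numerator and denominator of an
`x`-coordinate. -/
noncomputable def doubleRootPoly (Z : Finset F) : F[X] := X * ∏ c ∈ Z, (X - C c) ^ 2

theorem monic_doubleRootPoly (Z : Finset F) : (doubleRootPoly Z).Monic :=
  monic_X.mul (monic_prod_of_monic _ _ fun c _ => (monic_X_sub_C c).pow 2)

theorem natDegree_doubleRootPoly (Z : Finset F) :
    (doubleRootPoly Z).natDegree = 2 * Z.card + 1 := by
  have hmonic : ∀ c ∈ Z, ((X - C c) ^ 2).Monic := fun c _ => (monic_X_sub_C c).pow 2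
  rw [doubleRootPoly, monic_X.natDegree_mul (monic_prod_of_monic _ _ hmonic),
    natDegree_prod_of_monic _ _ hmonic]
  simp only [natDegree_X, natDegree_pow, natDegree_X_sub_C, Finset.sum_const, smul_eq_mul]
  ring

theorem doubleRootPoly_dvd {Z : Finset F} {P : F[X]} (hX : X ∣ P) (h0 : (0 : F) ∉ Z)
    (hZ : ∀ c ∈ Z, (X - C c) ^ 2 ∣ P) : doubleRootPoly Z ∣ P := by
  have hcop {c d : F} (h : c ≠ d) : IsCoprime (X - C c) (X - C d) :=
    pairwise_coprime_X_sub_C Function.injective_id h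
  refine IsCoprime.mul_dvd (.prod_right fun c hc => .pow_right ?_) hX
    (Finset.prod_dvd_of_coprime (fun c _ d _ h => (hcop h).pow) hZ)
  simpa using hcop (ne_of_mem_of_not_mem hc h0).symm

theorem natDegree_X_pow_add_X {q : ℕ} (hq : 1 < q) : (X ^ q + X : F[X]).natDegree = q := by
  rw [natDegree_add_eq_left_of_natDegree_lt] <;> simp [hq]

variable [CharP F 2]

theorem biquadratic_X_pow_eq_zero {q : ℕ} {b : F} {N : F[X]}
    (hN : N ^ 2 + X ^ (q + 1) * N = (X ^ q + X) ^ 2 * (X ^ (2 * q + 2) + C b)) :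
    biquadratic b (X ^ q) 1 N ((X ^ q + X) ^ 2) = 0 := by
  rw [biquadratic]
  linear_combination (X ^ q + X) ^ 2 * hN +
    ((X ^ q + X) ^ 4 * (X ^ (2 * q + 2) + C b) - X ^ (q + 1) * N ^ 2) *
      CharTwo.two_eq_zero (R := F[X])

theorem sq_X_sub_C_dvd_sq_X_pow_add_X {q : ℕ} {c : F} (hc : c ^ q = c) :
    (X - C c) ^ 2 ∣ (X ^ q + X : F[X]) ^ 2 :=
  pow_dvd_pow_of_dvd (dvd_iff_isRoot.mpr (by simp [hc, CharTwo.add_self_eq_zero])) 2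

theorem sq_X_sub_C_dvd_of_eval_eq_zero {q : ℕ} {b c : F} {N : F[X]}
    (hN : N ^ 2 + X ^ (q + 1) * N = (X ^ q + X) ^ 2 * (X ^ (2 * q + 2) + C b))
    (hcq : c ^ q = c) (hc : c ≠ 0) (hNc : N.eval c = 0) : (X - C c) ^ 2 ∣ N := by
  have hcop : IsCoprime (X - C c) (N + X ^ (q + 1)) := by
    rw [(irreducible_X_sub_C c).coprime_iff_not_dvd, dvd_iff_isRoot]
    simp [hNc, hc]
  refine (hcop.pow_left (m := 2)).dvd_of_dvd_mul_right ?_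
  rw [show N * (N + X ^ (q + 1)) = N ^ 2 + X ^ (q + 1) * N by ring, hN]
  exact (sq_X_sub_C_dvd_sq_X_pow_add_X hcq).mul_right _

theorem quadratic_nonneg_of_eval_eq_zero [Fintype F] {b : F} {N : F[X]} {q : ℕ}
    (hF : Fintype.card F = q)
    (hN : N ^ 2 + X ^ (q + 1) * N = (X ^ q + X) ^ 2 * (X ^ (2 * q + 2) + C b))
    (hX : X ∣ N) (hdeg : N.natDegree ≤ 2 * q + 1) {Z : Finset F} (h0 : (0 : F) ∉ Z)
    (hZ : ∀ c ∈ Z, N.eval c = 0) (n : ℕ) :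
    0 ≤ (n : ℤ) ^ 2 + n * (q - 1 - 2 * Z.card) + q := by
  have hpow (c : F) : c ^ q = c := hF ▸ FiniteField.pow_card c
  have hq : 1 < q := hF ▸ Fintype.one_lt_card
  have hXq : X ∣ (X ^ q + X : F[X]) := dvd_add (dvd_pow_self X (by omega)) dvd_rfl
  obtain ⟨M, rfl⟩ := doubleRootPoly_dvd hX h0 fun c hc =>
    sq_X_sub_C_dvd_of_eval_eq_zero hN (hpow c) (ne_of_mem_of_not_mem hc h0) (hZ c hc)
  obtain ⟨A, hA⟩ := doubleRootPoly_dvd (hXq.trans (dvd_pow_self _ two_ne_zero)) h0 fun c _ =>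
    sq_X_sub_C_dvd_sq_X_pow_add_X (hpow c)
  have hΦ := biquadratic_X_pow_eq_zero hN
  have hmonic := monic_doubleRootPoly Z
  rw [hA, biquadratic_mul_mul] at hΦ
  replace hΦ := (mul_eq_zero.mp hΦ).resolve_left (pow_ne_zero 2 hmonic.ne_zero)
  have hA0 : A ≠ 0 := by
    rintro rfl
    have := congrArg natDegree hA
    rw [natDegree_pow, natDegree_X_pow_add_X hq, mul_zero, natDegree_zero] at this
    omega
  have hAdeg : 2 * q = 2 * Z.card + 1 + A.natDegree := by
    simpa only [natDegree_pow, natDegree_X_pow_add_X hq, hmonic.natDegree_mul' hA0,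
      natDegree_doubleRootPoly] using congrArg natDegree hA
  have hMdeg : M.natDegree ≤ 2 * q - 2 * Z.card := by
    rcases eq_or_ne M 0 with rfl | hM
    · simp
    · rw [hmonic.natDegree_mul' hM, natDegree_doubleRootPoly] at hdeg
      omega
  have hheight : height M A ≤ 2 * q - 2 * Z.card := max_le hMdeg (by omega)
  have hheightX : height (X ^ q : F[X]) 1 = q := by simp [height]
  have := quadratic_nonneg_of_height_le (c := q - 1 - 2 * Z.card) isCoprime_one_right (.inr hA0) hΦ
    (by rw [hheightX]; omega) n
  rwa [hheightX] at this

end Weil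

section Numerator

open Polynomial

theorem sum_range_succ_add_sum_range {R : Type*} [CommRing R] [CharP R 2] (f : ℕ → R) (r : ℕ) :
    ∑ i ∈ Finset.range r, f (i + 1) + ∑ i ∈ Finset.range r, f i = f r + f 0 := by
  simpa only [CharTwo.sub_eq_add, Finset.sum_add_distrib] using Finset.sum_range_sub f r

/-- The trace polynomial `X + X² + X⁴ + ⋯` over a field with `2 ^ r` elements. -/
noncomputable def tracePoly (F : Type*) [Field F] (r : ℕ) : F[X] :=
  ∑ i ∈ Finset.range r, X ^ 2 ^ i

/-- The trace polynomial evaluated at `b / X²`, multiplied by `X ^ 2 ^ r`. -/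
noncomputable def invTracePoly {F : Type*} [Field F] (r : ℕ) (b : F) : F[X] :=
  ∑ i ∈ Finset.range r, C (b ^ 2 ^ i) * X ^ (2 ^ r - 2 ^ (i + 1))

/-- The numerator, over the denominator `(X ^ 2 ^ r + X)²`, of the `x`-coordinate of the sum of
`(X, 0)` and its image `(X ^ 2 ^ r, _)` under Frobenius, on the curve of `biquadratic`. -/
noncomputable def frobNumerator {F : Type*} [Field F] (r : ℕ) (b : F) : F[X] :=
  X * (X ^ 2 ^ r * tracePoly F r + invTracePoly r b + X ^ 2 ^ r * (X ^ 2 ^ r + X))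

variable {F : Type*} [Field F] {r : ℕ} {b : F}

theorem natDegree_frobNumerator_le : (frobNumerator r b).natDegree ≤ 2 * 2 ^ r + 1 := by
  have hX : (X : F[X]).natDegree ≤ 2 ^ r := natDegree_X_le.trans Nat.one_le_two_pow
  have hXq : (X ^ 2 ^ r : F[X]).natDegree ≤ 2 ^ r := natDegree_X_pow_le _
  have hS : (tracePoly F r).natDegree ≤ 2 ^ r :=
    natDegree_sum_le_of_forall_le _ _ fun i hi => (natDegree_X_pow_le _).trans
      (Nat.pow_le_pow_right two_pos (Finset.mem_range.mp hi).le)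
  have hR : (invTracePoly r b).natDegree ≤ 2 ^ r + 2 ^ r :=
    natDegree_sum_le_of_forall_le _ _ fun i _ => (natDegree_C_mul_X_pow_le _ _).trans
      ((Nat.sub_le _ _).trans (Nat.le_add_right _ _))
  have hsum := natDegree_add_le_of_degree_le
    (natDegree_add_le_of_degree_le (natDegree_mul_le_of_le hXq hS) hR)
    (natDegree_mul_le_of_le hXq (natDegree_add_le_of_degree_le hXq hX))
  exact (natDegree_mul_le_of_le natDegree_X_le hsum).trans_eq (by ring)

variable [CharP F 2]

theorem tracePoly_sq_add_self : tracePoly F r ^ 2 + tracePoly F r = X ^ 2 ^ r + X := by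
  have := sum_range_succ_add_sum_range (fun i => (X : F[X]) ^ 2 ^ i) r
  rw [tracePoly, CharTwo.sum_sq]
  simpa only [← pow_mul, ← pow_succ, pow_zero, pow_one] using this

theorem invTracePoly_sq_add : invTracePoly r b ^ 2 + X ^ 2 ^ r * invTracePoly r b =
    C b * X ^ (2 * 2 ^ r - 2) + C (b ^ 2 ^ r) := by
  have hsum := sum_range_succ_add_sum_range
    (fun i => C (b ^ 2 ^ i) * X ^ (2 * 2 ^ r - 2 ^ (i + 1))) r
  rw [pow_succ' 2 r, Nat.sub_self, pow_zero, pow_zero, pow_one, mul_one, zero_add, pow_one,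
    add_comm (C _)] at hsum
  rw [← hsum, invTracePoly, CharTwo.sum_sq, Finset.mul_sum]
  refine congrArg₂ (· + ·) (Finset.sum_congr rfl fun i _ => ?_)
    (Finset.sum_congr rfl fun i hi => ?_)
  · rw [mul_pow, ← C_pow, ← pow_mul b, ← pow_mul X, ← pow_succ, Nat.sub_mul, mul_comm _ 2,
      ← pow_succ]
  · have : 2 ^ (i + 1) ≤ 2 ^ r := Nat.pow_le_pow_right two_pos (Finset.mem_range.mp hi)
    rw [mul_left_comm, ← pow_add, show 2 ^ r + (2 ^ r - 2 ^ (i + 1)) = 2 * 2 ^ r - 2 ^ (i + 1) by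
      omega]

theorem frobNumerator_sq_add (hb : b ^ 2 ^ r = b) :
    frobNumerator r b ^ 2 + X ^ (2 ^ r + 1) * frobNumerator r b =
      (X ^ 2 ^ r + X) ^ 2 * (X ^ (2 * 2 ^ r + 2) + C b) := by
  have hS := tracePoly_sq_add_self (F := F) (r := r)
  have hR := invTracePoly_sq_add (r := r) (b := b)
  have hX : X ^ 2 * (X : F[X]) ^ (2 * 2 ^ r - 2) = (X ^ 2 ^ r) ^ 2 := by
    have : 1 ≤ 2 ^ r := Nat.one_le_two_pow
    rw [← pow_add, ← pow_mul]
    congr 1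
    omega
  rw [frobNumerator, pow_succ _ (2 ^ r), show (X : F[X]) ^ (2 * 2 ^ r + 2) = (X ^ 2 ^ r) ^ 2 * X ^ 2
    by rw [← pow_mul, ← pow_add, mul_comm 2]]
  rw [hb] at hR
  generalize (X : F[X]) ^ 2 ^ r = T at *
  linear_combination X ^ 2 * T ^ 2 * hS + X ^ 2 * hR + C b * hX +
    (X ^ 2 * (T * tracePoly F r * invTracePoly r b
      + (T * tracePoly F r + invTracePoly r b) * T * (T + X) + T ^ 3 + T ^ 2 * X)
      - X * C b * T) * CharTwo.two_eq_zero (R := F[X])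

theorem eval_frobNumerator {c : F} (hc : c ≠ 0) (hcq : c ^ 2 ^ r = c) :
    (frobNumerator r b).eval c =
      c ^ 2 * ∑ i ∈ Finset.range r, (c + b * c⁻¹ ^ 2) ^ 2 ^ i := by
  have hinv : (invTracePoly r b).eval c = c * ∑ i ∈ Finset.range r, (b * c⁻¹ ^ 2) ^ 2 ^ i := by
    simp only [invTracePoly, eval_finsetSum, Finset.mul_sum, eval_mul, eval_C, eval_pow, eval_X]
    refine Finset.sum_congr rfl fun i hi => ?_
    rw [pow_sub₀ c hc (Nat.pow_le_pow_right two_pos (Finset.mem_range.mp hi)), hcq, mul_pow,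
      ← pow_mul, ← pow_succ', inv_pow, mul_left_comm]
  simp only [add_pow_char_pow, Finset.sum_add_distrib]
  rw [frobNumerator]
  simp only [eval_mul, eval_add, eval_pow, eval_X, hinv, hcq, CharTwo.add_self_eq_zero, tracePoly,
    eval_finsetSum]
  ring

end Numerator

section Character

theorem prod_units_mul {F M : Type*} [Field F] [Fintype F] [DecidableEq F] [CommMonoid M]
    (f : F → M) : (∏ x : Fˣ, f x) * f 0 = ∏ x, f x := by
  rw [← Finset.prod_erase_mul _ f (Finset.mem_univ 0),
    Finset.prod_subtype (p := (· ≠ 0)) _ (by simp) f]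
  exact congrArg (· * f 0) (Fintype.prod_equiv unitsEquivNeZero _ (fun x => f x.1) fun _ => rfl)

theorem sum_units_add {F M : Type*} [Field F] [Fintype F] [DecidableEq F] [AddCommMonoid M]
    (f : F → M) : ∑ x : Fˣ, f x + f 0 = ∑ x, f x :=
  prod_units_mul (M := Multiplicative M) f

theorem natCast_card_units {F : Type*} [Field F] [Fintype F] [DecidableEq F] :
    (Fintype.card Fˣ : ℤ) = Fintype.card F - 1 := by
  rw [Fintype.card_units, Nat.cast_pred Fintype.card_pos]

variable {F : Type*} [Field F] [Algebra (ZMod 2) F]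

theorem charP_two (F : Type*) [Field F] [Algebra (ZMod 2) F] : CharP F 2 :=
  charP_of_injective_algebraMap (algebraMap (ZMod 2) F).injective 2

theorem tr_add (x y : F) : tr (x + y) = tr x + tr y := map_add _ x y

theorem tr_zero : tr (0 : F) = 0 := map_zero _

theorem lam_eq_ite (x : F) : lam x = if tr x = 0 then 1 else -1 := by
  rw [lam]
  generalize tr x = u
  decide +revert

theorem lam_eq_one_iff {x : F} : lam x = 1 ↔ tr x = 0 := by
  rw [lam_eq_ite]
  split_ifs with h <;> simp [h]

/-- The canonical additive character `λ` as a bundled `AddChar`. -/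
noncomputable def lamChar (F : Type*) [Field F] [Algebra (ZMod 2) F] : AddChar F ℤ where
  toFun := lam
  map_zero_eq_one' := by simp [lam, tr_zero]
  map_add_eq_mul' x y := by
    rw [lam, lam, lam, tr_add]
    generalize tr x = u
    generalize tr y = v
    decide +revert

theorem lam_zero : lam (0 : F) = 1 := (lamChar F).map_zero_eq_one

theorem lam_add (x y : F) : lam (x + y) = lam x * lam y := (lamChar F).map_add_eq_mul x y

theorem lam_sum {ι : Type*} (s : Finset ι) (f : ι → F) :
    lam (∑ i ∈ s, f i) = ∏ i ∈ s, lam (f i) :=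
  map_prod (lamChar F).toMonoidHom (fun i => Multiplicative.ofAdd (f i)) s

theorem tr_sq [Finite F] (x : F) : tr (x ^ 2) = tr x := by
  simpa [tr] using Algebra.trace_eq_of_algEquiv
    (FiniteField.frobeniusAlgEquivOfAlgebraic (ZMod 2) F) x

theorem lam_sq [Finite F] (x : F) : lam (x ^ 2) = lam x := by rw [lam, lam, tr_sq]

theorem isPrimitive_lamChar [Finite F] : (lamChar F).IsPrimitive := by
  intro a ha htriv
  exact ha ((traceForm_nondegenerate (ZMod 2) F).1 a fun x =>
    lam_eq_one_iff.mp (DFunLike.congr_fun htriv x))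

variable [Fintype F]

theorem algebraMap_tr {r : ℕ} (hF : Fintype.card F = 2 ^ r) (x : F) :
    algebraMap (ZMod 2) F (tr x) = ∑ i ∈ Finset.range r, x ^ 2 ^ i := by
  have hr : Module.finrank (ZMod 2) F = r := by
    have := Module.card_eq_pow_finrank (K := ZMod 2) (V := F)
    rw [hF, ZMod.card] at this
    exact (Nat.pow_right_injective le_rfl this).symm
  rw [tr, FiniteField.algebraMap_trace_eq_sum_pow, hr, Nat.card_zmod]

variable [DecidableEq F]

theorem sum_lam_mul (a : F) :
    ∑ x : F, lam (x * a) = if a = 0 then (Fintype.card F : ℤ) else 0 := by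
  have := AddChar.sum_mulShift a (isPrimitive_lamChar (F := F))
  push_cast at this
  exact this

theorem sum_units_lam_mul (a : F) :
    ∑ x : Fˣ, lam ((x : F) * a) = (if a = 0 then (Fintype.card F : ℤ) else 0) - 1 := by
  rw [← sum_lam_mul, ← sum_units_add fun x => lam (x * a), zero_mul, lam_zero, add_sub_cancel_right]

end Character

section KloostermanModFour

theorem odd_card_of_involution {α : Type*} {s : Finset α} {σ : α → α} {y : α} (hy : y ∈ s)
    (hσ : ∀ x ∈ s, σ x ∈ s) (hσσ : ∀ x ∈ s, σ (σ x) = x) (hfix : ∀ x ∈ s, σ x = x ↔ x = y) :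
    Odd s.card := by
  classical
  have hsum := Finset.sum_involution (s := s.erase y) (f := fun _ => (1 : ZMod 2)) (fun x _ => σ x)
    (fun _ _ => by decide) (fun x hx _ => by grind) (fun x hx => by grind) (fun x hx => by grind)
  rw [← Finset.card_erase_add_one hy]
  exact Even.add_one (by simpa [ZMod.natCast_eq_zero_iff_even] using hsum)

theorem exists_sq_eq_units {F : Type*} [Field F] [Finite F] [CharP F 2] (a : Fˣ) :
    ∃ s : Fˣ, s ^ 2 = a := by
  obtain ⟨s, hs⟩ := FiniteField.isSquare_of_char_two (ringChar.eq F 2) (a : F)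
  have hs0 : s ≠ 0 := by
    rintro rfl
    simp at hs
  exact ⟨Units.mk0 s hs0, Units.ext (by simp [hs, sq])⟩

variable {F : Type*} [Field F] [Fintype F] [DecidableEq F] [Algebra (ZMod 2) F]

theorem K_one (a : Fˣ) : K 1 a = ∑ x : Fˣ, lam ((x : F) + a * (x : F)⁻¹) :=
  Fintype.sum_equiv (Equiv.funUnique (Fin 1) Fˣ) _ _ fun x => by simp

/-- The arguments `x` of the terms equal to `1` in the Kloosterman sum `K 1 a`; the other terms are
`-1`. -/
noncomputable def kloostermanZeros (a : Fˣ) : Finset Fˣ := {x | tr ((x : F) + a * (x : F)⁻¹) = 0}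

theorem K_one_eq_card (a : Fˣ) :
    K 1 a = 2 * ((kloostermanZeros a).card : ℤ) - (Fintype.card F - 1) := by
  have hcard := Finset.card_filter_add_card_filter_not (s := Finset.univ)
    fun x : Fˣ => tr ((x : F) + a * (x : F)⁻¹) = 0
  rw [Finset.card_univ] at hcard
  rw [K_one, kloostermanZeros, ← natCast_card_units, ← hcard]
  simp only [lam_eq_ite, Finset.sum_ite, Finset.sum_const, nsmul_eq_mul]
  push_cast
  linarith

theorem odd_card_kloostermanZeros (a : Fˣ) : Odd (kloostermanZeros a).card := by
  have := charP_two F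
  obtain ⟨s, rfl⟩ := exists_sq_eq_units a
  refine odd_card_of_involution (σ := fun x => s ^ 2 * x⁻¹) (y := s) ?_ ?_ ?_ ?_
  · simp [kloostermanZeros, sq, CharTwo.add_self_eq_zero, tr_zero]
  · intro x hx
    simpa [kloostermanZeros, add_comm, mul_comm] using hx
  · simp
  · intro x _
    rw [mul_inv_eq_iff_eq_mul, ← sq, eq_comm]
    refine ⟨fun h => Units.ext (CharTwo.sq_injective (R := F) ?_), fun h => by rw [h]⟩
    simpa using congrArg Units.val h

theorem K_one_modEq {r : ℕ} (hr : 2 ≤ r) (hF : Fintype.card F = 2 ^ r) (a : Fˣ) :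
    K 1 a ≡ -1 [ZMOD 4] := by
  obtain ⟨m, hm⟩ := odd_card_kloostermanZeros a
  obtain ⟨k, rfl⟩ := Nat.exists_eq_add_of_le hr
  rw [K_one_eq_card, hm, hF]
  refine Int.modEq_iff_dvd.mpr ⟨2 ^ k - m - 1, ?_⟩
  push_cast
  ring

end KloostermanModFour

section WeilBound

open Polynomial

variable {F : Type*} [Field F] [Fintype F] {r : ℕ}

theorem quadratic_nonneg_of_units_eval_eq_zero [CharP F 2] (hF : Fintype.card F = 2 ^ r) {b : F}
    {N : F[X]} (hN : N ^ 2 + X ^ (2 ^ r + 1) * N =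
      (X ^ 2 ^ r + X) ^ 2 * (X ^ (2 * 2 ^ r + 2) + C b))
    (hX : X ∣ N) (hdeg : N.natDegree ≤ 2 * 2 ^ r + 1) {Z : Finset Fˣ}
    (hZ : ∀ x ∈ Z, N.eval (x : F) = 0) (n : ℕ) :
    0 ≤ (n : ℤ) ^ 2 + n * (2 ^ r - 1 - 2 * Z.card) + 2 ^ r := by
  simpa using quadratic_nonneg_of_eval_eq_zero hF hN hX hdeg
    (Z := Z.map ⟨Units.val, Units.val_injective⟩) (by simp) (by simpa using hZ) n

variable [Algebra (ZMod 2) F]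

theorem eval_frobNumerator_sq (hF : Fintype.card F = 2 ^ r) (a x : Fˣ) :
    (frobNumerator r ((a : F) ^ 2)).eval (x : F) =
      x ^ 2 * algebraMap (ZMod 2) F (tr ((x : F) + a * (x : F)⁻¹)) := by
  have := charP_two F
  rw [eval_frobNumerator x.ne_zero (hF ▸ FiniteField.pow_card _), ← algebraMap_tr hF, tr_add,
    ← mul_pow, tr_sq, ← tr_add]

variable [DecidableEq F]

theorem quadratic_nonneg_card_kloostermanZeros (hF : Fintype.card F = 2 ^ r) (a : Fˣ) (n : ℕ) :
    0 ≤ (n : ℤ) ^ 2 + n * (2 ^ r - 1 - 2 * (kloostermanZeros a).card) + 2 ^ r := by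
  have := charP_two F
  refine quadratic_nonneg_of_units_eval_eq_zero hF
    (frobNumerator_sq_add (hF ▸ FiniteField.pow_card ((a : F) ^ 2))) (dvd_mul_right _ _)
    natDegree_frobNumerator_le (fun x hx => ?_) n
  rw [eval_frobNumerator_sq hF, (Finset.mem_filter.mp hx).2, map_zero, mul_zero]

-- The other root `N + X ^ (2 ^ r + 1)` of the equation for `N` belongs to the point with
-- `(X, 0)` replaced by its negative, and vanishes where `λ(x + a / x) = -1`.
theorem quadratic_nonneg_card_compl_kloostermanZeros (hF : Fintype.card F = 2 ^ r) (a : Fˣ)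
    (n : ℕ) : 0 ≤ (n : ℤ) ^ 2 + n * (2 ^ r - 1 - 2 * (kloostermanZeros a)ᶜ.card) + 2 ^ r := by
  have := charP_two F
  have hN := frobNumerator_sq_add (hF ▸ FiniteField.pow_card ((a : F) ^ 2))
  refine quadratic_nonneg_of_units_eval_eq_zero hF (b := (a : F) ^ 2)
    (N := frobNumerator r ((a : F) ^ 2) + X ^ (2 ^ r + 1)) ?_
    (dvd_add (dvd_mul_right _ _) (dvd_pow_self X (by omega)))
    (natDegree_add_le_of_degree_le natDegree_frobNumerator_le
      ((natDegree_X_pow_le _).trans (by omega))) (fun x hx => ?_) n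
  · linear_combination hN + (X ^ (2 ^ r + 1) * frobNumerator r ((a : F) ^ 2)
      + (X ^ (2 ^ r + 1)) ^ 2) * CharTwo.two_eq_zero (R := F[X])
  · have htr0 : tr ((x : F) + a * (x : F)⁻¹) ≠ 0 := by simpa [kloostermanZeros] using hx
    have htr : tr ((x : F) + a * (x : F)⁻¹) = 1 := Fin.eq_one_of_ne_zero _ htr0
    rw [eval_add, eval_frobNumerator_sq hF, htr, map_one, eval_pow, eval_X, pow_succ _ (2 ^ r),
      ← hF, FiniteField.pow_card, mul_one, sq, CharTwo.add_self_eq_zero]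

theorem K_one_quadratic_nonneg (hF : Fintype.card F = 2 ^ r) (a : Fˣ) (n : ℤ) :
    0 ≤ n ^ 2 - n * K 1 a + 2 ^ r := by
  have hK := K_one_eq_card a
  have hcompl : ((kloostermanZeros a).card : ℤ) + (kloostermanZeros a)ᶜ.card = 2 ^ r - 1 := by
    have := natCast_card_units (F := F)
    rw [hF] at this
    rw [← Finset.card_add_card_compl (kloostermanZeros a)] at this
    exact_mod_cast this
  rw [hF] at hK
  push_cast at hK
  rcases Int.eq_nat_or_neg n with ⟨m, rfl | rfl⟩
  · have := quadratic_nonneg_card_kloostermanZeros hF a m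
    rw [hK]
    linarith
  · have := quadratic_nonneg_card_compl_kloostermanZeros hF a m
    rw [eq_sub_of_add_eq' hcompl] at this
    rw [hK]
    linarith

theorem eq_one_or_neg_one_of_odd_of_dvd_two_pow {m : ℤ} (hm : Odd m) (h : m ∣ 2 ^ r) :
    m = 1 ∨ m = -1 :=
  Int.isUnit_iff.mp <| IsCoprime.isUnit_of_dvd' (b := 2 ^ r)
    ((Int.isCoprime_two_right.mpr hm).pow_right) dvd_rfl h

theorem K_one_sq_lt (hr : 2 ≤ r) (hF : Fintype.card F = 2 ^ r) (a : Fˣ) :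
    K 1 a ^ 2 < 4 * 2 ^ r := by
  obtain ⟨k, hk⟩ := (K_one_modEq hr hF a).dvd
  obtain ⟨m, hm⟩ : ∃ m, K 1 a = 2 * m + 1 := ⟨-2 * k - 1, by linarith⟩
  have hnonneg := K_one_quadratic_nonneg hF a m
  have h4 : (2 : ℤ) ^ 2 ≤ 2 ^ r := pow_le_pow_right₀ (by norm_num) hr
  have hne : m * (m + 1) ≠ 2 ^ r := by
    intro h
    have hodd : Odd m := ⟨-k - 1, by linarith⟩
    rcases eq_one_or_neg_one_of_odd_of_dvd_two_pow hodd ⟨m + 1, h.symm⟩ with rfl | rfl <;> omega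
  have hlt : m * (m + 1) < 2 ^ r := lt_of_le_of_ne (by rw [hm] at hnonneg; linarith) hne
  rw [hm]
  linarith

theorem abs_K_one_lt (hr : 2 ≤ r) (hF : Fintype.card F = 2 ^ r) (a : Fˣ) :
    |(K 1 a : ℝ)| < 2 * √(Fintype.card F : ℝ) := by
  refine abs_lt_of_sq_lt_sq ?_ (by positivity)
  rw [mul_pow, Real.sq_sqrt (by positivity), hF]
  norm_num
  exact_mod_cast K_one_sq_lt hr hF a

theorem K_one_mem_valueRange (hr : 2 ≤ r) (hF : Fintype.card F = 2 ^ r) (a : Fˣ) :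
    K 1 a ∈ valueRange (Fintype.card F) :=
  (mem_valueRange _ _).mpr ⟨abs_K_one_lt hr hF a, K_one_modEq hr hF a⟩

theorem prod_valueRange {M : Type*} [CommMonoid M] (hr : 2 ≤ r) (hF : Fintype.card F = 2 ^ r)
    (g : ℤ → Fˣ → M) :
    ∏ t ∈ valueRange (Fintype.card F), ∏ β : Fˣ with K 1 β⁻¹ = t, g t β =
      ∏ β : Fˣ, g (K 1 β⁻¹) β := by
  rw [← Finset.prod_fiberwise_of_maps_to (g := fun β : Fˣ => K 1 β⁻¹) (t := valueRange _)
    fun β _ => K_one_mem_valueRange hr hF β⁻¹]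
  refine Finset.prod_congr rfl fun t _ => Finset.prod_congr rfl fun β hβ => ?_
  rw [(Finset.mem_filter.mp hβ).2]

end WeilBound

section Binomials

open Polynomial Finset

theorem binom_natCast (n k : ℕ) : binom n k = n.choose k := by
  simp [binom, Ring.choose_natCast]

theorem binom_sub_sub_eq_zero {n j t : ℕ} (hj : j ≤ n) (htj : t < j) :
    binom ((n : ℤ) - j) ((n : ℤ) - t) = 0 := by
  rw [← Nat.cast_sub hj, ← Nat.cast_sub (by omega), binom_natCast,
    Nat.choose_eq_zero_of_lt (by omega), Nat.cast_zero]

theorem coeff_X_pow_mul_one_add_X_pow {n j : ℕ} (hj : j ≤ n) (t : ℕ) :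
    (X ^ j * (1 + X) ^ (n - j) : ℤ[X]).coeff t = binom ((n : ℤ) - j) ((n : ℤ) - t) := by
  rw [coeff_X_pow_mul', coeff_one_add_X_pow]
  rcases lt_or_ge t j with htj | htj
  · rw [if_neg htj.not_ge, binom_sub_sub_eq_zero hj htj]
  rw [if_pos htj]
  rcases le_or_gt t n with ht | ht
  · rw [← Nat.cast_sub hj, ← Nat.cast_sub ht, binom_natCast,
      Nat.choose_symm_of_eq_add (by omega : n - j = t - j + (n - t))]
  · rw [Nat.choose_eq_zero_of_lt (by omega), binom, if_neg (by omega), Nat.cast_zero]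

theorem coeff_one_add_two_mul_X_pow (n t : ℕ) :
    ((1 + 2 * X) ^ n : ℤ[X]).coeff t = 2 ^ t * n.choose t := by
  have hcomp : ((1 + 2 * X) ^ n : ℤ[X]) = ((1 + X) ^ n).comp (C 2 * X) := by simp
  rw [hcomp, comp_C_mul_X_coeff, coeff_one_add_X_pow, mul_comm]

theorem pow_eq_sum_stirlingSecond_mul_descFactorial (x h : ℕ) :
    x ^ h = ∑ t ∈ range (h + 1), Nat.stirlingSecond h t * x.descFactorial t := by
  induction h with
  | zero => simp
  | succ h ih =>
    have hmul (t : ℕ) :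
        x.descFactorial t * x = x.descFactorial (t + 1) + t * x.descFactorial t := by
      rw [Nat.descFactorial_succ]
      rcases le_or_gt t x with htx | htx
      · rw [← add_mul, Nat.sub_add_cancel htx, mul_comm]
      · simp [Nat.descFactorial_eq_zero_iff_lt.mpr htx]
    have hshift : ∑ t ∈ range (h + 1), Nat.stirlingSecond h t * (t * x.descFactorial t) =
        ∑ t ∈ range (h + 1),
          Nat.stirlingSecond h (t + 1) * ((t + 1) * x.descFactorial (t + 1)) := by
      rw [sum_range_succ', sum_range_succ _ h,
        Nat.stirlingSecond_eq_zero_of_lt h.lt_succ_self]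
      simp
    rw [pow_succ, ih, sum_mul, sum_range_succ' _ (h + 1),
      Nat.stirlingSecond_succ_zero, zero_mul, add_zero]
    simp_rw [mul_assoc, hmul, mul_add, sum_add_distrib, hshift, ← sum_add_distrib,
      Nat.stirlingSecond_succ_succ]
    exact sum_congr rfl fun t _ => by ring

theorem pow_eq_sum_stirlingSecond_mul_choose (x h : ℕ) :
    x ^ h = ∑ t ∈ range (h + 1), t ! * Nat.stirlingSecond h t * x.choose t := by
  rw [pow_eq_sum_stirlingSecond_mul_descFactorial]
  exact sum_congr rfl fun t _ => by rw [Nat.descFactorial_eq_factorial_mul_choose]; ring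

theorem pow_eq_sum_range_add_sub_pow {R : Type*} [CommRing R] (x y : R) (n : ℕ) :
    x ^ n = ∑ l ∈ range n, (-1) ^ (n + l + 1) * (n.choose l : R) * y ^ (n - l) * x ^ l +
      (x - y) ^ n := by
  rw [sub_pow, sum_range_succ, ← add_assoc, ← sum_add_distrib,
    sum_eq_zero fun l _ => by ring, zero_add, (Even.add_self n).neg_one_pow]
  simp

end Binomials

section PowerMoments

open Polynomial Finset

variable {F : Type*} [Field F] [Algebra (ZMod 2) F] {ι : Type*} [Fintype ι]

/-- The bijection between binary vectors and their supports. -/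
def supportEquiv (ι : Type*) [Fintype ι] [DecidableEq ι] : (ι → ZMod 2) ≃ Finset ι where
  toFun u := {i | u i ≠ 0}
  invFun J i := if i ∈ J then 1 else 0
  left_inv u := by
    ext i
    simp only [mem_filter, mem_univ, true_and]
    generalize u i = x
    decide +revert
  right_inv J := by ext; simp

theorem mem_binaryCode_iff (v : ι → F) (u : ι → ZMod 2) :
    u ∈ binaryCode v ↔ ∑ i with u i ≠ 0, v i = 0 := by
  have hterm (i : ι) : algebraMap (ZMod 2) F (u i) * v i = if u i ≠ 0 then v i else 0 := by
    obtain h | h : u i = 0 ∨ u i = 1 := Fin.exists_fin_two.mp ⟨u i, rfl⟩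
    · simp [h]
    · simp [h]
  rw [sum_filter, ← sum_congr rfl fun i _ => hterm i]
  rfl

theorem weightCount_eq_card [DecidableEq F] (v : ι → F) (j : ℕ) :
    weightCount (binaryCode v) j =
      #{J ∈ (univ : Finset ι).powersetCard j | ∑ i ∈ J, v i = 0} := by
  have := Classical.decEq ι
  rw [← Nat.card_eq_finsetCard, weightCount]
  refine Nat.card_congr ((supportEquiv ι).subtypeEquiv fun u => ?_)
  simpa [mem_binaryCode_iff, supportEquiv, hammingNorm] using and_comm

/-- The Hamming weight of the vector `(tr (a v_i))_i`. -/
noncomputable def traceWeight (v : ι → F) (a : F) : ℕ := #{i | tr (a * v i) ≠ 0}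

theorem sum_lam_mul_eq_sub_traceWeight (v : ι → F) (a : F) :
    ∑ i, lam (a * v i) = Fintype.card ι - 2 * (traceWeight v a : ℤ) := by
  have hlam (i : ι) : lam (a * v i) = 1 - if tr (a * v i) ≠ 0 then 2 else 0 := by
    rw [lam_eq_ite]
    split_ifs <;> simp_all
  rw [sum_congr rfl fun i _ => hlam i]
  simp only [sum_sub_distrib, ← sum_filter, sum_const, traceWeight]
  simp [mul_comm]

theorem prod_one_add_X_add_neg_lam (v : ι → F) (a : F) :
    ∏ i, (-C (lam (a * v i)) * X + (1 + X)) = (1 + 2 * X) ^ traceWeight v a := by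
  have hfactor (i : ι) : -C (lam (a * v i)) * X + (1 + X) =
      if tr (a * v i) ≠ 0 then 1 + 2 * X else 1 := by
    rw [lam_eq_ite]
    split_ifs
    · contradiction
    · simp
    · simp
      ring
  rw [prod_congr rfl fun i _ => hfactor i, ← prod_filter, prod_const]
  rfl

variable [Fintype F]

theorem sum_lam_mul_sum [DecidableEq F] {κ : Type*} (v : κ → F) (J : Finset κ) :
    ∑ a : F, ∏ i ∈ J, lam (a * v i) = if ∑ i ∈ J, v i = 0 then (Fintype.card F : ℤ) else 0 := by
  simp_rw [← lam_sum, ← mul_sum, sum_lam_mul]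

/-- The MacWilliams identity: the vectors `(tr (a v_i))_i` span the dual of `binaryCode v`. -/
theorem sum_one_add_two_mul_X_pow_traceWeight (v : ι → F) :
    ∑ a, (1 + 2 * X) ^ traceWeight v a =
      C (Fintype.card F : ℤ) * ∑ j ∈ range (Fintype.card ι + 1),
        C ((-1) ^ j * (weightCount (binaryCode v) j : ℤ)) *
          (X ^ j * (1 + X) ^ (Fintype.card ι - j)) := by
  have := Classical.decEq ι
  have := Classical.decEq F
  have hexpand (a : F) : (1 + 2 * X) ^ traceWeight v a = ∑ J ∈ univ.powerset,
      C (∏ i ∈ J, lam (a * v i)) * ((-X) ^ #J * (1 + X) ^ (Fintype.card ι - #J)) := by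
    rw [← prod_one_add_X_add_neg_lam, prod_add]
    refine sum_congr rfl fun J _ => ?_
    simp only [neg_mul, ← mul_neg, prod_mul_distrib, prod_const, map_prod,
      ← compl_eq_univ_sdiff, card_compl, mul_assoc]
  simp_rw [hexpand]
  rw [sum_comm]
  simp_rw [← sum_mul, ← map_sum, sum_lam_mul_sum, sum_powerset, card_univ,
    mul_sum]
  refine sum_congr rfl fun j _ => ?_
  rw [sum_congr rfl fun J hJ => by rw [(mem_powersetCard.mp hJ).2],
    ← sum_mul, ← map_sum, ← sum_filter, sum_const, ← weightCount_eq_card,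
    neg_pow (X : ℤ[X])]
  simp only [nsmul_eq_mul, map_mul, map_natCast, map_pow, map_neg, map_one]
  ring

theorem two_pow_mul_sum_choose_traceWeight (v : ι → F) (t : ℕ) :
    2 ^ t * ∑ a, ((traceWeight v a).choose t : ℤ) =
      Fintype.card F * ∑ j ∈ range (Fintype.card ι + 1),
        (-1) ^ j * (weightCount (binaryCode v) j : ℤ) *
          binom ((Fintype.card ι : ℤ) - j) ((Fintype.card ι : ℤ) - t) := by
  have h := congrArg (coeff · t) (sum_one_add_two_mul_X_pow_traceWeight v)
  simp only [finsetSum_coeff, coeff_one_add_two_mul_X_pow, coeff_C_mul] at h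
  rw [mul_sum, h]
  congr 1
  refine sum_congr rfl fun j hj => ?_
  rw [coeff_X_pow_mul_one_add_X_pow (mem_range_succ_iff.mp hj)]

/-- The double sum over weights `j` and `t` in the Pless power moment identity of order `h` for a
binary code. -/
noncomputable def plessSum (B : Submodule (ZMod 2) (ι → ZMod 2)) (h : ℕ) : ℤ :=
  ∑ j ∈ range (min (Fintype.card ι) h + 1), (-1) ^ (h + j) * (weightCount B j : ℤ) *
    ∑ t ∈ Icc j h, (t ! : ℤ) * (Nat.stirlingSecond h t : ℤ) * 2 ^ (h - t) *
      binom ((Fintype.card ι : ℤ) - j) ((Fintype.card ι : ℤ) - t)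

theorem plessSum_eq_sum_range (B : Submodule (ZMod 2) (ι → ZMod 2)) (h : ℕ) :
    plessSum B h = ∑ t ∈ range (h + 1), ∑ j ∈ range (Fintype.card ι + 1),
      (t ! : ℤ) * (Nat.stirlingSecond h t : ℤ) * 2 ^ (h - t) *
        ((-1) ^ (h + j) * (weightCount B j : ℤ) *
          binom ((Fintype.card ι : ℤ) - j) ((Fintype.card ι : ℤ) - t)) := by
  rw [sum_comm, plessSum]
  refine (sum_subset (range_mono (by omega)) fun j hj hj' => ?_).trans <|
    sum_congr rfl fun j hj => ?_
  · have hlt : h < j := by simp at hj hj'; omega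
    rw [Icc_eq_empty (by omega), sum_empty, mul_zero]
  · rw [mul_sum]
    refine (sum_subset (fun t => by simp) fun t ht ht' => ?_).trans
      (sum_congr rfl fun t _ => by ring)
    have hlt : t < j := by simp at ht ht'; omega
    rw [binom_sub_sub_eq_zero (mem_range_succ_iff.mp hj) hlt, mul_zero, mul_zero]

theorem sum_sub_card_pow_eq_plessSum (v : ι → F) (h : ℕ) :
    ∑ a : F, (∑ i, lam (a * v i) - Fintype.card ι) ^ h =
      Fintype.card F * plessSum (binaryCode v) h := by
  have hpow (a : F) : (∑ i, lam (a * v i) - (Fintype.card ι : ℤ)) ^ h =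
      ∑ t ∈ range (h + 1), (-1) ^ h * (t ! : ℤ) * (Nat.stirlingSecond h t : ℤ) *
        2 ^ (h - t) * (2 ^ t * (traceWeight v a).choose t) := by
    rw [sum_lam_mul_eq_sub_traceWeight, sub_sub_cancel_left, neg_pow, mul_pow, ← Nat.cast_pow,
      pow_eq_sum_stirlingSecond_mul_choose]
    push_cast
    simp_rw [mul_sum]
    refine sum_congr rfl fun t ht => ?_
    rw [← pow_sub_mul_pow 2 (mem_range_succ_iff.mp ht)]
    ring
  simp_rw [hpow]
  rw [sum_comm, plessSum_eq_sum_range]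
  simp_rw [← mul_sum, two_pow_mul_sum_choose_traceWeight, mul_sum]
  refine sum_congr rfl fun t _ => sum_congr rfl fun j _ => ?_
  ring

theorem sum_units_pow_eq_sum_range_add_plessSum [DecidableEq F] {v : ι → F} {g : Fˣ → ℤ} {A : ℤ}
    (hg : ∀ x : Fˣ, ∑ i, lam ((x : F) * v i) = g x + A) {h : ℕ} (hh : 1 ≤ h) :
    ∑ x, g x ^ h = ∑ l ∈ range h, (-1) ^ (h + l + 1) * (h.choose l : ℤ) *
      (Fintype.card ι - A) ^ (h - l) * ∑ x, g x ^ l +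
        Fintype.card F * plessSum (binaryCode v) h := by
  have hunits := sum_units_add fun a : F => (∑ i, lam (a * v i) - (Fintype.card ι : ℤ)) ^ h
  simp only [hg, zero_mul, lam_zero, sum_const, card_univ, nsmul_one, sub_self,
    zero_pow (Nat.ne_of_gt hh), add_zero] at hunits
  rw [← sum_sub_card_pow_eq_plessSum, ← hunits]
  simp_rw [mul_sum]
  rw [sum_comm, ← sum_add_distrib]
  refine sum_congr rfl fun x _ => ?_
  rw [pow_eq_sum_range_add_sub_pow (g x) (Fintype.card ι - A) h]
  ring

end PowerMoments

section Fibers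

open Finset

/-- The number of coordinates in `J` at which `v` takes the value `β`. -/
def fiberCard {ι κ : Type*} [DecidableEq κ] (v : ι → κ) (J : Finset ι) (β : κ) : ℕ :=
  #{i ∈ J | v i = β}

theorem sum_fiberCard {ι κ : Type*} [DecidableEq κ] {v : ι → κ} {S : Finset κ}
    (hS : ∀ i, v i ∈ S) (J : Finset ι) : ∑ β ∈ S, fiberCard v J β = #J :=
  (card_eq_sum_card_fiberwise fun i _ => hS i).symm

theorem sum_fiberCard_mul {ι F : Type*} [Semiring F] [DecidableEq F] {v : ι → F} {S : Finset F}
    (hS : ∀ i, v i ∈ S) (J : Finset ι) :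
    ∑ β ∈ S, (fiberCard v J β : F) * β = ∑ i ∈ J, v i := by
  rw [← sum_fiberwise_of_maps_to (fun i _ => hS i) v]
  refine sum_congr rfl fun β _ => ?_
  rw [sum_congr rfl fun i hi => (mem_filter.mp hi).2, sum_const, nsmul_eq_mul, fiberCard]

theorem card_filter_fiberCard_eq {ι κ : Type*} [Fintype ι] [Fintype κ] [DecidableEq κ]
    (v : ι → κ) (ν : κ → ℕ) :
    #{J : Finset ι | fiberCard v J = ν} = ∏ β, (fiberCard v univ β).choose (ν β) := by
  have := Classical.decEq ι
  have hmem {f : κ → Finset ι}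
      (hf : f ∈ Fintype.piFinset fun β => powersetCard (ν β) {i | v i = β}) (β : κ) :
      {i ∈ ({i | i ∈ f (v i)} : Finset ι) | v i = β} = f β := by
    have hsub := (mem_powersetCard.mp (Fintype.mem_piFinset.mp hf β)).1
    ext i
    refine ⟨by simp +contextual [eq_comm], fun hi => ?_⟩
    have hv : v i = β := by simpa using hsub hi
    simpa [hv] using hi
  simp_rw [fiberCard, ← card_powersetCard, ← Fintype.card_piFinset]
  refine card_nbij' (fun J β => {i ∈ J | v i = β}) (fun f => ({i | i ∈ f (v i)} : Finset ι))
    ?_ ?_ ?_ ?_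
  · intro J hJ
    have hJ' := congrFun (mem_filter.mp hJ).2
    exact Fintype.mem_piFinset.mpr fun β =>
      mem_powersetCard.mpr ⟨filter_subset_filter _ (subset_univ J), hJ' β⟩
  · intro f hf
    refine mem_filter.mpr ⟨mem_univ _, funext fun β => ?_⟩
    rw [fiberCard, hmem hf, (mem_powersetCard.mp (Fintype.mem_piFinset.mp hf β)).2]
  · intro J _
    simp
  · intro f hf
    exact funext (hmem hf)

variable {F : Type*} [Field F] [DecidableEq F] [Algebra (ZMod 2) F] {ι : Type*} [Fintype ι]

theorem weightCount_eq_sum_families [Finite F] {v : ι → F} {S : Finset F} (hS : ∀ i, v i ∈ S)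
    (j : ℕ) :
    weightCount (binaryCode v) j =
      ∑ ν ∈ families S j, ∏ β ∈ S, (fiberCard v univ β).choose (ν β) := by
  have := Fintype.ofFinite F
  have hmem (J : Finset ι) : fiberCard v J ∈ families S j ↔ #J = j ∧ ∑ i ∈ J, v i = 0 := by
    rw [families, mem_filter, mem_piAntidiag, sum_fiberCard hS, sum_fiberCard_mul hS]
    refine and_congr_left fun _ => and_iff_left fun β hβ => ?_
    obtain ⟨i, hi⟩ := card_ne_zero.mp hβ
    exact (mem_filter.mp hi).2 ▸ hS i
  have hcode : ({J ∈ (univ : Finset ι).powersetCard j | ∑ i ∈ J, v i = 0} : Finset (Finset ι)) =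
      ({J | fiberCard v J ∈ families S j} : Finset (Finset ι)) := by
    ext J
    simp [hmem]
  rw [weightCount_eq_card, hcode, card_eq_sum_card_fiberwise (f := fiberCard v) (t := families S j)
    fun J hJ => by simpa using hJ]
  refine sum_congr rfl fun ν hν => ?_
  have hsupp (β : F) (hβ : β ∉ S) : ν β = 0 :=
    of_not_not fun h => hβ ((mem_piAntidiag.mp (mem_filter.mp hν).1).2 β h)
  rw [prod_subset (subset_univ S) fun β _ hβ => by rw [hsupp β hβ, Nat.choose_zero_right],
    ← card_filter_fiberCard_eq, filter_filter]
  congr 1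
  ext J
  simp only [mem_filter, mem_univ, true_and, and_iff_right_iff_imp]
  rintro rfl
  exact hν

variable [Fintype F]

theorem weightCount_eq_sum_binom {v : ι → F} {m : ℤ} {g : Fˣ → ℤ}
    (h0 : (fiberCard v univ 0 : ℤ) = m) (hg : ∀ β : Fˣ, (fiberCard v univ (β : F) : ℤ) = g β)
    (j : ℕ) :
    (weightCount (binaryCode v) j : ℤ) =
      ∑ ν ∈ families (univ : Finset F) j, binom m (ν 0) * ∏ β : Fˣ, binom (g β) (ν β) := by
  rw [weightCount_eq_sum_families (S := univ) (by simp)]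
  push_cast
  simp_rw [← binom_natCast]
  refine sum_congr rfl fun ν _ => ?_
  rw [← prod_units_mul fun β : F => binom (fiberCard v univ β) (ν β), h0, mul_comm]
  simp_rw [hg]

theorem card_mul_fiberCard (v : ι → F) (β : F) :
    (Fintype.card F : ℤ) * fiberCard v univ β =
      Fintype.card ι + ∑ x : Fˣ, lam ((x : F) * β) * ∑ i, lam ((x : F) * v i) := by
  have := charP_two F
  have hsum := sum_units_add fun x : F => lam (x * β) * ∑ i, lam (x * v i)
  simp only [zero_mul, lam_zero, one_mul, sum_const, card_univ, nsmul_one] at hsum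
  rw [add_comm, hsum]
  simp_rw [mul_sum, ← lam_add, ← mul_add]
  rw [sum_comm]
  simp_rw [sum_lam_mul, CharTwo.add_eq_zero, eq_comm (a := β), ← sum_filter, sum_const,
    nsmul_eq_mul]
  rw [fiberCard, mul_comm]

end Fibers

section KloostermanIdentities

open Finset

variable {F : Type*} [Field F] [Fintype F] [DecidableEq F] [Algebra (ZMod 2) F]

theorem K_zero (a : Fˣ) : K 0 a = lam (a : F) := by
  simp [K]

theorem K_succ (m : ℕ) (a : Fˣ) : K (m + 1) a = ∑ s : Fˣ, lam (s : F) * K m (a * s⁻¹) := by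
  simp_rw [K, mul_sum, ← lam_add]
  rw [← Fintype.sum_prod_type']
  refine (Fintype.sum_equiv (Fin.consEquiv fun _ => Fˣ) _ _ fun p => ?_).symm
  simp [Fin.consEquiv, Fin.sum_univ_succ, Fin.prod_univ_succ, add_assoc, mul_assoc, mul_comm]

theorem sum_K (m : ℕ) : ∑ x : Fˣ, K m x = (-1) ^ (m + 1) := by
  have hlam : ∑ x : Fˣ, lam (x : F) = -1 := by
    simpa using sum_units_lam_mul (1 : F)
  induction m with
  | zero => simp_rw [K_zero, hlam, zero_add, pow_one]
  | succ m ih =>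
    simp_rw [K_succ]
    rw [sum_comm]
    have hshift (s : Fˣ) : ∑ x : Fˣ, K m (x * s⁻¹) = ∑ x : Fˣ, K m x :=
      Equiv.sum_comp (Equiv.mulRight s⁻¹) (K m)
    simp_rw [← mul_sum, hshift, ih]
    rw [← sum_mul, hlam, pow_succ' _ (m + 1)]

theorem sum_lam_mul_K_succ (m : ℕ) (β : Fˣ) :
    ∑ x : Fˣ, lam ((x : F) * β) * K (m + 1) x = Fintype.card F * K m β⁻¹ + (-1) ^ m := by
  have := charP_two F
  calc
    _ = ∑ s : Fˣ, ∑ x : Fˣ, lam ((x : F) * β) * (lam (s : F) * K m (x * s⁻¹)) := by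
      simp_rw [K_succ, mul_sum]
      exact sum_comm
    _ = ∑ s : Fˣ, ∑ y : Fˣ, lam ((s : F) * (y * β + 1)) * K m y := by
      refine sum_congr rfl fun s _ => Fintype.sum_equiv (Equiv.mulRight s⁻¹) _ _ fun x => ?_
      rw [← mul_assoc, ← lam_add]
      congr 2
      simp
      field_simp
    _ = ∑ y : Fˣ, (if y = β⁻¹ then Fintype.card F * K m y else 0) - ∑ y : Fˣ, K m y := by
      rw [sum_comm, ← sum_sub_distrib]
      refine sum_congr rfl fun y _ => ?_
      rw [← sum_mul, sum_units_lam_mul]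
      simp_rw [CharTwo.add_eq_zero, ← Units.val_mul, Units.val_eq_one, ← eq_inv_iff_mul_eq_one]
      split_ifs <;> ring
    _ = _ := by
      rw [sum_ite_eq' univ, if_pos (mem_univ _), sum_K]
      ring

theorem K_sq (m : ℕ) (a : Fˣ) : K m (a ^ 2) = K m a := by
  have := charP_two F
  have hsq : Function.Bijective fun x : Fˣ => x ^ 2 :=
    Finite.surjective_iff_bijective.mp exists_sq_eq_units
  refine (Fintype.sum_equiv (Equiv.piCongrRight fun _ : Fin m => Equiv.ofBijective _ hsq) _ _
    fun α => ?_).symm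
  rw [← lam_sq, CharTwo.add_sq, CharTwo.sum_sq]
  simp [mul_pow, ← prod_pow]

theorem K_pow_two_pow (m s : ℕ) (a : Fˣ) : K m (a ^ 2 ^ s) = K m a := by
  induction s with
  | zero => simp
  | succ s ih => rw [pow_succ, pow_mul, K_sq, ih]

theorem sum_lam_mul_add_inv (a : Fˣ) :
    ∑ u : Fˣ, lam ((a : F) * ((u : F) + (u : F)⁻¹)) = K 1 a := by
  rw [← K_sq, K_one]
  refine Fintype.sum_equiv (Equiv.mulLeft a) _ _ fun u => ?_
  congr 1
  simp
  field_simp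

theorem K_one_sq_eq_sum (a : Fˣ) :
    K 1 a ^ 2 = ∑ u : Fˣ, ∑ x : Fˣ, lam ((x : F) * (1 + u) + a * ((1 + u) * (x * u : F)⁻¹)) := by
  rw [K_one, sq, sum_mul_sum, sum_comm' (t' := univ) (s' := fun _ => univ) (by simp), sum_comm]
  conv_rhs => rw [sum_comm]
  refine sum_congr rfl fun x _ => Fintype.sum_equiv (Equiv.mulLeft x⁻¹) _ _ fun y => ?_
  rw [← lam_add]
  congr 1
  simp
  field_simp
  ring

-- For `u ≠ 1` this is the substitution `x ↦ x / (1 + u)`, as `(1 + u) ^ 2 / u = u + u⁻¹`.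
theorem sum_lam_mul_one_add (a u : Fˣ) :
    ∑ x : Fˣ, lam ((x : F) * (1 + u) + a * ((1 + u) * (x * u : F)⁻¹)) =
      ∑ x : Fˣ, lam ((x : F) + a * (x : F)⁻¹ * (u + (u : F)⁻¹)) +
        if u = 1 then (Fintype.card F : ℤ) else 0 := by
  have := charP_two F
  split_ifs with hu
  · have hlam := sum_units_lam_mul (1 : F)
    simp only [mul_one, one_ne_zero, if_false, zero_sub] at hlam
    simp [hu, CharTwo.add_self_eq_zero, lam_zero, natCast_card_units, hlam, neg_add_eq_sub]
  · have h1 : (1 + u : F) ≠ 0 := fun h =>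
      hu (Units.ext (by simpa using (CharTwo.add_eq_zero.mp h).symm))
    rw [add_zero]
    refine Fintype.sum_equiv (Equiv.mulRight (Units.mk0 _ h1)) _ _ fun x => ?_
    have h2 : (u : F) + (u : F)⁻¹ = (1 + u) ^ 2 * (u : F)⁻¹ := by
      rw [CharTwo.add_sq]
      field_simp
      ring
    congr 1
    simp only [Equiv.coe_mulRight, Units.val_mul, Units.val_mk0, h2]
    field_simp

theorem K_one_sq (a : Fˣ) : K 1 a ^ 2 = K 2 a + Fintype.card F := by
  simp_rw [K_one_sq_eq_sum, sum_lam_mul_one_add, sum_add_distrib, lam_add]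
  rw [sum_ite_eq' univ, if_pos (mem_univ _), sum_comm, K_succ 1]
  simp_rw [← mul_sum]
  congr 1
  refine sum_congr rfl fun s _ => ?_
  rw [← sum_lam_mul_add_inv]
  simp

end KloostermanIdentities

section Codewords

open Finset

variable (F : Type*) [Field F] [Fintype F] [DecidableEq F]

/-- The vector defining the code `C_k`. -/
def vecC (k : ℕ) (α : Fin k → Fˣ) : F := ∑ i, (α i : F) + ∏ i, (α i : F)⁻¹

/-- The vector defining the code `D_k`. -/
def vecD (k : ℕ) (α : Fin k → Fˣ) : F := ∑ i, (α i : F) + ∑ i, (α i : F)⁻¹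

theorem natCast_card_pi_units (k : ℕ) :
    (Fintype.card (Fin k → Fˣ) : ℤ) = (Fintype.card F - 1) ^ k := by
  rw [Fintype.card_fun, Fintype.card_fin, Nat.cast_pow, natCast_card_units]

variable {F} [Algebra (ZMod 2) F]

theorem sum_lam_mul_vecC {k s : ℕ} (hk : k + 1 = 2 ^ s) (x : Fˣ) :
    ∑ α, lam ((x : F) * vecC F k α) = K k x := by
  rw [← K_pow_two_pow k s, ← hk]
  refine Fintype.sum_equiv (Equiv.piCongrRight fun _ => Equiv.mulLeft x) _ _ fun α => ?_
  have hx : (x : F) ^ (k + 1) * ((x : F) ^ k)⁻¹ = x := by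
    rw [pow_succ']
    field_simp
  simp [vecC, mul_add, mul_sum, prod_mul_distrib, ← mul_assoc, mul_right_comm _ _ ((x : F) ^ k)⁻¹,
    hx]

theorem sum_lam_mul_vecD (k : ℕ) (x : Fˣ) :
    ∑ α, lam ((x : F) * vecD F k α) = K 1 x ^ k := by
  rw [← sum_lam_mul_add_inv, Fintype.sum_pow]
  simp_rw [vecD, ← sum_add_distrib, mul_sum, lam_sum]

theorem card_mul_fiberCard_vecC {k s : ℕ} (hk : k + 1 = 2 ^ s) (β : F) :
    (Fintype.card F : ℤ) * fiberCard (vecC F k) univ β =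
      (Fintype.card F - 1) ^ k + ∑ x : Fˣ, lam ((x : F) * β) * K k x := by
  simp_rw [card_mul_fiberCard, natCast_card_pi_units, sum_lam_mul_vecC hk]

theorem card_mul_fiberCard_vecD_two (β : F) :
    (Fintype.card F : ℤ) * fiberCard (vecD F 2) univ β =
      (Fintype.card F - 1) ^ 2 + ∑ x : Fˣ, lam ((x : F) * β) * K 2 x +
        Fintype.card F * ∑ x : Fˣ, lam ((x : F) * β) := by
  simp_rw [card_mul_fiberCard, natCast_card_pi_units, sum_lam_mul_vecD, K_one_sq, mul_add,
    sum_add_distrib, ← sum_mul]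
  ring

theorem fiberCard_vecC_one_zero : (fiberCard (vecC F 1) univ 0 : ℤ) = 1 := by
  apply mul_left_cancel₀ (Nat.cast_ne_zero.mpr (Fintype.card_ne_zero (α := F)))
  simp_rw [card_mul_fiberCard_vecC (s := 1) rfl, mul_zero, lam_zero, one_mul, sum_K]
  ring

theorem fiberCard_vecC_one_units (β : Fˣ) :
    (fiberCard (vecC F 1) univ (β : F) : ℤ) = 1 + lam (β : F)⁻¹ := by
  apply mul_left_cancel₀ (Nat.cast_ne_zero.mpr (Fintype.card_ne_zero (α := F)))
  rw [card_mul_fiberCard_vecC (s := 1) rfl, sum_lam_mul_K_succ, K_zero, Units.val_inv_eq_inv_val]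
  ring

theorem fiberCard_vecC_three_zero :
    (fiberCard (vecC F 3) univ 0 : ℤ) = (Fintype.card F : ℤ) ^ 2 - 3 * Fintype.card F + 3 := by
  apply mul_left_cancel₀ (Nat.cast_ne_zero.mpr (Fintype.card_ne_zero (α := F)))
  simp_rw [card_mul_fiberCard_vecC (s := 2) rfl, mul_zero, lam_zero, one_mul, sum_K]
  ring

theorem fiberCard_vecC_three_units (β : Fˣ) :
    (fiberCard (vecC F 3) univ (β : F) : ℤ) =
      K 1 β⁻¹ ^ 2 + (Fintype.card F : ℤ) ^ 2 - 4 * Fintype.card F + 3 := by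
  apply mul_left_cancel₀ (Nat.cast_ne_zero.mpr (Fintype.card_ne_zero (α := F)))
  rw [card_mul_fiberCard_vecC (s := 2) rfl, sum_lam_mul_K_succ, K_one_sq]
  ring

theorem fiberCard_vecD_two_zero :
    (fiberCard (vecD F 2) univ 0 : ℤ) = 2 * Fintype.card F - 3 := by
  apply mul_left_cancel₀ (Nat.cast_ne_zero.mpr (Fintype.card_ne_zero (α := F)))
  rw [card_mul_fiberCard_vecD_two, sum_units_lam_mul, if_pos rfl]
  simp_rw [mul_zero, lam_zero, one_mul, sum_K]
  ring

theorem fiberCard_vecD_two_units (β : Fˣ) :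
    (fiberCard (vecD F 2) univ (β : F) : ℤ) = K 1 β⁻¹ + Fintype.card F - 3 := by
  apply mul_left_cancel₀ (Nat.cast_ne_zero.mpr (Fintype.card_ne_zero (α := F)))
  rw [card_mul_fiberCard_vecD_two, sum_lam_mul_K_succ, sum_units_lam_mul, if_neg β.ne_zero]
  ring

theorem vecC_one_mem_insert_traceZero (α : Fin 1 → Fˣ) : vecC F 1 α ∈ insert 0 (traceZero F) := by
  rw [mem_insert, or_iff_not_imp_left]
  intro h0
  have hfiber : fiberCard (vecC F 1) univ (vecC F 1 α) ≠ 0 :=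
    card_ne_zero.mpr ⟨α, mem_filter.mpr ⟨mem_univ α, rfl⟩⟩
  refine mem_filter.mpr ⟨mem_univ _, h0, of_not_not fun htr => hfiber ?_⟩
  have hcard := fiberCard_vecC_one_units (Units.mk0 _ h0)
  rw [Units.val_mk0, lam_eq_ite, if_neg htr] at hcard
  simpa using hcard

theorem weightCount_codeC_one (j : ℕ) :
    (weightCount (codeC F 1) j : ℤ) = ∑ ν ∈ families (insert 0 (traceZero F)) j,
      binom 1 (ν 0) * ∏ β ∈ traceZero F, binom 2 (ν β) := by
  have hcard (β : F) (hβ : β ∈ traceZero F) : (fiberCard (vecC F 1) univ β : ℤ) = 2 := by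
    obtain ⟨h0, htr⟩ := (mem_filter.mp hβ).2
    have := fiberCard_vecC_one_units (Units.mk0 β h0)
    rwa [Units.val_mk0, lam_eq_one_iff.mpr htr] at this
  change (weightCount (binaryCode (vecC F 1)) j : ℤ) = _
  rw [weightCount_eq_sum_families vecC_one_mem_insert_traceZero]
  push_cast
  refine sum_congr rfl fun ν _ => ?_
  simp_rw [prod_insert (show (0 : F) ∉ traceZero F by simp [traceZero]), ← binom_natCast,
    fiberCard_vecC_one_zero]
  rw [prod_congr rfl fun β hβ => by rw [hcard β hβ]]

theorem weightCount_codeC_three (j : ℕ) :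
    (weightCount (codeC F 3) j : ℤ) = ∑ ν ∈ families (univ : Finset F) j,
      binom ((Fintype.card F : ℤ) ^ 2 - 3 * Fintype.card F + 3) (ν 0) *
        ∏ β : Fˣ, binom (K 1 β⁻¹ ^ 2 + (Fintype.card F : ℤ) ^ 2 - 4 * Fintype.card F + 3) (ν β) :=
  weightCount_eq_sum_binom fiberCard_vecC_three_zero fiberCard_vecC_three_units j

theorem weightCount_codeD_two (j : ℕ) :
    (weightCount (codeD F 2) j : ℤ) = ∑ ν ∈ families (univ : Finset F) j,
      binom (2 * (Fintype.card F : ℤ) - 3) (ν 0) *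
        ∏ β : Fˣ, binom (K 1 β⁻¹ + (Fintype.card F : ℤ) - 3) (ν β) :=
  weightCount_eq_sum_binom fiberCard_vecD_two_zero fiberCard_vecD_two_units j

end Codewords

section Moments

open Finset

variable {F : Type*} [Field F] [Fintype F] [DecidableEq F]

theorem plessSum_pi_units {k : ℕ} (B : Submodule (ZMod 2) ((Fin k → Fˣ) → ZMod 2)) (h : ℕ) :
    plessSum B h = ∑ j ∈ range (min ((Fintype.card F - 1) ^ k) h + 1),
      (-1) ^ (h + j) * (weightCount B j : ℤ) *
        ∑ t ∈ Icc j h, (t ! : ℤ) * (Nat.stirlingSecond h t : ℤ) * 2 ^ (h - t) *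
          binom (((Fintype.card F : ℤ) - 1) ^ k - j) (((Fintype.card F : ℤ) - 1) ^ k - t) := by
  rw [plessSum, natCast_card_pi_units, Fintype.card_fun, Fintype.card_fin, Fintype.card_units]

variable [Algebra (ZMod 2) F] {h : ℕ}

theorem MK_eq_sum_range_add_plessSum_codeC {k s : ℕ} (hk : k + 1 = 2 ^ s) (hh : 1 ≤ h) :
    MK F k h = ∑ l ∈ range h,
        (-1) ^ (h + l + 1) * (h.choose l : ℤ) * ((Fintype.card F : ℤ) - 1) ^ (k * (h - l)) *
          MK F k l + Fintype.card F * plessSum (codeC F k) h := by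
  have := sum_units_pow_eq_sum_range_add_plessSum (v := vecC F k) (g := K k) (A := 0)
    (fun x => by rw [sum_lam_mul_vecC hk, add_zero]) hh
  simp only [sub_zero, natCast_card_pi_units, ← pow_mul] at this
  exact this

theorem MK_one_mul_eq_sum_range_add_plessSum_codeD (k : ℕ) (hh : 1 ≤ h) :
    MK F 1 (k * h) = ∑ l ∈ range h,
        (-1) ^ (h + l + 1) * (h.choose l : ℤ) * ((Fintype.card F : ℤ) - 1) ^ (k * (h - l)) *
          MK F 1 (k * l) + Fintype.card F * plessSum (codeD F k) h := by
  have := sum_units_pow_eq_sum_range_add_plessSum (v := vecD F k) (g := fun x => K 1 x ^ k) (A := 0)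
    (fun x => by rw [sum_lam_mul_vecD, add_zero]) hh
  simp only [sub_zero, natCast_card_pi_units, ← pow_mul] at this
  exact this

theorem MK_two_eq_sum_range_add_plessSum_codeD (hh : 1 ≤ h) :
    MK F 2 h = ∑ l ∈ range h,
        (-1) ^ (h + l + 1) * (h.choose l : ℤ) *
          ((Fintype.card F : ℤ) ^ 2 - 3 * Fintype.card F + 1) ^ (h - l) * MK F 2 l +
      Fintype.card F * plessSum (codeD F 2) h := by
  have hA : ((Fintype.card F : ℤ) - 1) ^ 2 - Fintype.card F =
      (Fintype.card F : ℤ) ^ 2 - 3 * Fintype.card F + 1 := by ring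
  have := sum_units_pow_eq_sum_range_add_plessSum (v := vecD F 2) (g := K 2)
    (A := Fintype.card F) (fun x => by rw [sum_lam_mul_vecD, K_one_sq]) hh
  rw [natCast_card_pi_units, hA] at this
  exact this

end Moments

end KloostermanMoments

open KloostermanMoments in
theorem corollary2_general {F : Type*} [Field F] [Fintype F] [DecidableEq F] [Algebra (ZMod 2) F]
    (q r : ℕ) (hq : q = 2 ^ r) (hr : 2 ≤ r) (hF : Fintype.card F = q) :
    ((∀ h : ℕ, 1 ≤ h →
        MK F 1 h =
          ∑ l ∈ Finset.range h,
            (-1) ^ (h + l + 1) * (h.choose l : ℤ) * ((q : ℤ) - 1) ^ (h - l) * MK F 1 l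
          + (q : ℤ) * ∑ j ∈ Finset.range (min (q - 1) h + 1),
              (-1) ^ (h + j) * (weightCount (codeC F 1) j : ℤ) *
                ∑ t ∈ Finset.Icc j h, (t ! : ℤ) * (Nat.stirlingSecond h t : ℤ) * 2 ^ (h - t) *
                  binom ((q : ℤ) - 1 - j) ((q : ℤ) - 1 - t)) ∧
      (∀ j : ℕ,
        (weightCount (codeC F 1) j : ℤ) =
          ∑ ν ∈ families (insert 0 (traceZero F)) j,
            binom 1 (ν 0) * ∏ β ∈ traceZero F, binom 2 (ν β))) ∧
    ((∀ h : ℕ, 1 ≤ h →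
        MK F 3 h =
          ∑ l ∈ Finset.range h,
            (-1) ^ (h + l + 1) * (h.choose l : ℤ) * ((q : ℤ) - 1) ^ (3 * (h - l)) * MK F 3 l
          + (q : ℤ) * ∑ j ∈ Finset.range (min ((q - 1) ^ 3) h + 1),
              (-1) ^ (h + j) * (weightCount (codeC F 3) j : ℤ) *
                ∑ t ∈ Finset.Icc j h, (t ! : ℤ) * (Nat.stirlingSecond h t : ℤ) * 2 ^ (h - t) *
                  binom (((q : ℤ) - 1) ^ 3 - j) (((q : ℤ) - 1) ^ 3 - t)) ∧
      (∀ j : ℕ,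
        (weightCount (codeC F 3) j : ℤ) =
          ∑ ν ∈ families (Finset.univ : Finset F) j,
            binom ((q : ℤ) ^ 2 - 3 * q + 3) (ν 0) *
              ∏ t ∈ valueRange q, ∏ β : Fˣ with K 1 β⁻¹ = t,
                binom (t ^ 2 + (q : ℤ) ^ 2 - 4 * q + 3) (ν β))) ∧
    ((∀ h : ℕ, 1 ≤ h →
        MK F 1 (2 * h) =
          ∑ l ∈ Finset.range h,
            (-1) ^ (h + l + 1) * (h.choose l : ℤ) * ((q : ℤ) - 1) ^ (2 * (h - l)) *
              MK F 1 (2 * l)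
          + (q : ℤ) * ∑ j ∈ Finset.range (min ((q - 1) ^ 2) h + 1),
              (-1) ^ (h + j) * (weightCount (codeD F 2) j : ℤ) *
                ∑ t ∈ Finset.Icc j h, (t ! : ℤ) * (Nat.stirlingSecond h t : ℤ) * 2 ^ (h - t) *
                  binom (((q : ℤ) - 1) ^ 2 - j) (((q : ℤ) - 1) ^ 2 - t)) ∧
      (∀ j : ℕ,
        (weightCount (codeD F 2) j : ℤ) =
          ∑ ν ∈ families (Finset.univ : Finset F) j,
            binom (2 * (q : ℤ) - 3) (ν 0) *
              ∏ β : Fˣ, binom (K 1 β⁻¹ + (q : ℤ) - 3) (ν β) ∧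
        (weightCount (codeD F 2) j : ℤ) =
          ∑ ν ∈ families (Finset.univ : Finset F) j,
            binom (2 * (q : ℤ) - 3) (ν 0) *
              ∏ t ∈ valueRange q, ∏ β : Fˣ with K 1 β⁻¹ = t,
                binom (t + (q : ℤ) - 3) (ν β))) ∧
    (∀ h : ℕ, 1 ≤ h →
        MK F 2 h =
          ∑ l ∈ Finset.range h,
            (-1) ^ (h + l + 1) * (h.choose l : ℤ) * ((q : ℤ) ^ 2 - 3 * q + 1) ^ (h - l) *
              MK F 2 l
          + (q : ℤ) * ∑ j ∈ Finset.range (min ((q - 1) ^ 2) h + 1),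
              (-1) ^ (h + j) * (weightCount (codeD F 2) j : ℤ) *
                ∑ t ∈ Finset.Icc j h, (t ! : ℤ) * (Nat.stirlingSecond h t : ℤ) * 2 ^ (h - t) *
                  binom (((q : ℤ) - 1) ^ 2 - j) (((q : ℤ) - 1) ^ 2 - t)) := by
  subst hF
  simp_rw [← plessSum_pi_units]
  refine ⟨⟨fun h hh => ?_, weightCount_codeC_one⟩,
    ⟨fun h hh => MK_eq_sum_range_add_plessSum_codeC (s := 2) rfl hh, fun j => ?_⟩,
    ⟨fun h hh => MK_one_mul_eq_sum_range_add_plessSum_codeD 2 hh,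
      fun j => ⟨weightCount_codeD_two j, ?_⟩⟩,
    fun h hh => MK_two_eq_sum_range_add_plessSum_codeD hh⟩
  · simpa only [one_mul, plessSum_pi_units, pow_one] using
      MK_eq_sum_range_add_plessSum_codeC (k := 1) (s := 1) rfl hh
  · rw [weightCount_codeC_three]
    refine Finset.sum_congr rfl fun ν _ => ?_
    rw [prod_valueRange hr hq fun t β =>
      binom (t ^ 2 + (Fintype.card F : ℤ) ^ 2 - 4 * Fintype.card F + 3) (ν β)]
  · rw [weightCount_codeD_two]
    refine Finset.sum_congr rfl fun ν _ => ?_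
    rw [prod_valueRange hr hq fun t β => binom (t + (Fintype.card F : ℤ) - 3) (ν β)]

open KloostermanMoments in
theorem corollary2 {F : Type*} [Field F] [Fintype F] [DecidableEq F] [Algebra (ZMod 2) F]
    (q r : ℕ) (hq : q = 2 ^ r) (hr : 3 ≤ r) (hF : Fintype.card F = q) :
    -- (1)
    ((∀ h : ℕ, 1 ≤ h →
        MK F 1 h =
          ∑ l ∈ Finset.range h,
            (-1) ^ (h + l + 1) * (h.choose l : ℤ) * ((q : ℤ) - 1) ^ (h - l) * MK F 1 l
          + (q : ℤ) * ∑ j ∈ Finset.range (min (q - 1) h + 1),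
              (-1) ^ (h + j) * (weightCount (codeC F 1) j : ℤ) *
                ∑ t ∈ Finset.Icc j h, (t ! : ℤ) * (Nat.stirlingSecond h t : ℤ) * 2 ^ (h - t) *
                  binom ((q : ℤ) - 1 - j) ((q : ℤ) - 1 - t)) ∧
      (∀ j : ℕ, j ≤ q - 1 →
        (weightCount (codeC F 1) j : ℤ) =
          ∑ ν ∈ families (insert 0 (traceZero F)) j,
            binom 1 (ν 0) * ∏ β ∈ traceZero F, binom 2 (ν β))) ∧
    -- (2)
    ((∀ h : ℕ, 1 ≤ h →
        MK F 3 h =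
          ∑ l ∈ Finset.range h,
            (-1) ^ (h + l + 1) * (h.choose l : ℤ) * ((q : ℤ) - 1) ^ (3 * (h - l)) * MK F 3 l
          + (q : ℤ) * ∑ j ∈ Finset.range (min ((q - 1) ^ 3) h + 1),
              (-1) ^ (h + j) * (weightCount (codeC F 3) j : ℤ) *
                ∑ t ∈ Finset.Icc j h, (t ! : ℤ) * (Nat.stirlingSecond h t : ℤ) * 2 ^ (h - t) *
                  binom (((q : ℤ) - 1) ^ 3 - j) (((q : ℤ) - 1) ^ 3 - t)) ∧
      (∀ j : ℕ, j ≤ (q - 1) ^ 3 →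
        (weightCount (codeC F 3) j : ℤ) =
          ∑ ν ∈ families (Finset.univ : Finset F) j,
            binom ((q : ℤ) ^ 2 - 3 * q + 3) (ν 0) *
              ∏ t ∈ valueRange q, ∏ β : Fˣ with K 1 β⁻¹ = t,
                binom (t ^ 2 + (q : ℤ) ^ 2 - 4 * q + 3) (ν β))) ∧
    -- (3)
    ((∀ h : ℕ, 1 ≤ h →
        MK F 1 (2 * h) =
          ∑ l ∈ Finset.range h,
            (-1) ^ (h + l + 1) * (h.choose l : ℤ) * ((q : ℤ) - 1) ^ (2 * (h - l)) *
              MK F 1 (2 * l)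
          + (q : ℤ) * ∑ j ∈ Finset.range (min ((q - 1) ^ 2) h + 1),
              (-1) ^ (h + j) * (weightCount (codeD F 2) j : ℤ) *
                ∑ t ∈ Finset.Icc j h, (t ! : ℤ) * (Nat.stirlingSecond h t : ℤ) * 2 ^ (h - t) *
                  binom (((q : ℤ) - 1) ^ 2 - j) (((q : ℤ) - 1) ^ 2 - t)) ∧
      (∀ j : ℕ, j ≤ (q - 1) ^ 2 →
        (weightCount (codeD F 2) j : ℤ) =
          ∑ ν ∈ families (Finset.univ : Finset F) j,
            binom (2 * (q : ℤ) - 3) (ν 0) *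
              ∏ β : Fˣ, binom (K 1 β⁻¹ + (q : ℤ) - 3) (ν β) ∧
        (weightCount (codeD F 2) j : ℤ) =
          ∑ ν ∈ families (Finset.univ : Finset F) j,
            binom (2 * (q : ℤ) - 3) (ν 0) *
              ∏ t ∈ valueRange q, ∏ β : Fˣ with K 1 β⁻¹ = t,
                binom (t + (q : ℤ) - 3) (ν β))) ∧
    -- (4)
    (∀ h : ℕ, 1 ≤ h →
        MK F 2 h =
          ∑ l ∈ Finset.range h,
            (-1) ^ (h + l + 1) * (h.choose l : ℤ) * ((q : ℤ) ^ 2 - 3 * q + 1) ^ (h - l) *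
              MK F 2 l
          + (q : ℤ) * ∑ j ∈ Finset.range (min ((q - 1) ^ 2) h + 1),
              (-1) ^ (h + j) * (weightCount (codeD F 2) j : ℤ) *
                ∑ t ∈ Finset.Icc j h, (t ! : ℤ) * (Nat.stirlingSecond h t : ℤ) * 2 ^ (h - t) *
                  binom (((q : ℤ) - 1) ^ 2 - j) (((q : ℤ) - 1) ^ 2 - t)) := by
  obtain ⟨⟨h1, c1⟩, ⟨h2, c2⟩, ⟨h3, c3⟩, h4⟩ := corollary2_general q r hq (by lia) hF
  exact ⟨⟨h1, fun j _ => c1 j⟩, ⟨h2, fun j _ => c2 j⟩, ⟨h3, fun j _ => c3 j⟩, h4⟩
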